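/- An $r$-fold graph on $[n]=\{1,\dots,n\}$ is a tuple $\mathbf{G}=([n],E_1,\dots,E_r)$ with each $E_i\subseteq\binom{[n]}{2}$. The jigsaw process on $\mathbf{G}$ starts with the partition of $[n]$ into $n$ single-vertex clusters. In each step one forms the auxiliary graph on the current clusters in which two distinct clusters are adjacent if for every $i\in\{1,\dots,r\}$ some edge of $E_i$ joins a vertex of one to a vertex of the other, and merges all clusters lying in a common connected component of this auxiliary graph; the process stops when the auxiliary graph has no edges. $\mathbf{G}$ percolates if the process ends with exactly one cluster. The $r$-fold binomial random graph $\mathbf{G}(n,p_1,\dots,p_r)$ is the $r$-fold graph whose colours $([n],E_i)\sim G(n,p_i)$ are independent binomial random graphs. An event holds with high probability (whp) if its probability tends to $1$ as $n\to\infty$. Theorem. For every integer $r\ge 2$ there is a constant $C_r>0$ such that the following holds. Let $p_1,\dots,p_r$ be functions of $n$ with $0\le p_1\le p_2\le\dots\le p_r\le 1$ for every $n$, let $P_i=p_1p_2\cdots p_i$ for $1\le i\le r$, and let $\mathbf{G}=\mathbf{G}(n,p_1,\dots,p_r)$. (i) If, for all sufficiently large $n$, $P_i\le\dfrac{1}{C_r\,n(\ln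 n)^{i-1}}$ for some $2\le i\le r$ (which may depend on $n$) or $P_1\le\dfrac{\ln n}{C_r\,n}$, then whp $\mathbf{G}$ does not percolate. (ii) If, for all sufficiently large $n$, $P_i\ge\dfrac{C_r}{n(\ln n)^{i-1}}$ for every $2\le i\le r$ and $P_1\ge\dfrac{C_r\ln n}{n}$, then whp $\mathbf{G}$ percolates. -/

import Mathlib

open Filter Topology MeasureTheory

namespace Jigsaw

/-- An `r`-fold graph on the vertex set `V`: one simple graph on `V` for each of `r` colours. -/
abbrev RFoldGraph (V : Type*) (r : ℕ) : Type _ := Fin r → SimpleGraph V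

/-- The auxiliary graph on the clusters of a partition `s` of the vertex set (a partition is
given by its equivalence relation, its clusters are the equivalence classes): two distinct
clusters are joined if, for every colour, some edge of that colour runs between them. -/
def clusterGraph {V : Type*} {r : ℕ} (G : RFoldGraph V r) (s : Setoid V) :
    SimpleGraph (Quotient s) where
  Adj a b := a ≠ b ∧ ∀ i : Fin r, ∃ u v : V,
    Quotient.mk s u = a ∧ Quotient.mk s v = b ∧ (G i).Adj u v
  symm := ⟨fun _ _ h => ⟨h.1.symm, fun i =>
    let ⟨u, v, hu, hv, huv⟩ := h.2 i
    ⟨v, u, hv, hu, huv.symm⟩⟩⟩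
  loopless := ⟨fun _ h => h.1 rfl⟩

/-- One step of the algorithm: all clusters that lie in the same connected component of the
auxiliary graph are merged. -/
def step {V : Type*} {r : ℕ} (G : RFoldGraph V r) (s : Setoid V) : Setoid V :=
  (clusterGraph G s).reachableSetoid.comap (Quotient.mk s)

/-- The partition at time `t`, starting with the discrete partition at time `0`. When the
auxiliary graph has no edges (in particular when only one cluster is left), the algorithm stops;
here the partition then simply stays constant. -/
def partition {V : Type*} {r : ℕ} (G : RFoldGraph V r) : ℕ → Setoid V
  | 0 => ⊥
  | t + 1 => step G (partition G t)

/-- `G` percolates if the algorithm ends with exactly one cluster. -/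
def Percolates {V : Type*} {r : ℕ} (G : RFoldGraph V r) : Prop :=
  ∃ t : ℕ, Nat.card (Quotient (partition G t)) = 1

/-- The law of the `r`-fold binomial random graph: the graph of colour `i` is the binomial
random graph `G(n, p i)`, and the `r` colours are independent. -/
noncomputable def rFoldBinomial (n : ℕ) {r : ℕ} (p : Fin r → unitInterval) :
    Measure (RFoldGraph (Fin n) r) :=
  Measure.pi fun i => SimpleGraph.binomialRandom (Fin n) (p i)

/-- The product of the first `i` of the probabilities `p`. -/
noncomputable def prefixProd {r : ℕ} (p : Fin r → unitInterval) (i : ℕ) : ℝ :=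
  ∏ j : Fin r with j.val < i, (p j : ℝ)

end Jigsaw

/-! ### Independence of coloured pairs and a calculus of events -/

namespace Jigsaw

open ProbabilityTheory

/-! Below the threshold. Every cluster is connected in every colour, and a merging step can be
carried out one adjacent cluster at a time, so sizes at most double before a check is possible. A
percolating graph therefore contains, with `m = ⌈log n⌉`, a set of `k ∈ [m, 2m]` vertices connected
in every colour (`Percolates.exists_connectedIn`). Spanning trees are counted by parent functions,
so the expected number of such `k`-sets is at most `(n choose k) (k^j P_j)^(k-1)`, which is
`O(n^(-2))` when `P_j` is small. If instead `p_1` is small, that colour has an isolated vertex,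
whose cluster never grows (`prob_percolates_le_of_sparse_color`).

Above the threshold. From one vertex, grow layers of sizes `1, 2, 4, …` up to about `(log n)^2`,
every vertex of a layer having a neighbour in the preceding layer in each colour. All layers end in
one cluster. A vertex is joined to a `k`-set with probability at least `2^(-r) k^m P_m` for some `m
≤ r` (`exists_le_joinProb`). The cost of the chain is concentrated on layers of size near `log n`,
and its success probability is at least `n^(-1/2)` (`le_prod_layerProb`). A failed trial spoils only
`O((log n)^2)` vertices, so order `n / (log n)^2` trials are available and some chain succeeds with
high probability (`prob_noSeed_le`). A union bound shows that every proper set of at least `(log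
n)^2` vertices has an outside vertex joined to it (`prob_exists_closed_le`). A final cluster of that
size must then be everything (`percolates_of_grows`). -/

theorem iIndepFun_map_of_comp {ι α β : Type*} [MeasurableSpace α] [MeasurableSpace β]
    {γ : ι → Type*} [∀ i, MeasurableSpace (γ i)] {μ : Measure α} [IsProbabilityMeasure μ]
    {f : α → β} (hf : Measurable f) {X : ∀ i, β → γ i} (hX : ∀ i, Measurable (X i))
    (h : iIndepFun (fun i a => X i (f a)) μ) : iIndepFun X (μ.map f) := by
  have := Measure.isProbabilityMeasure_map (μ := μ) hf.aemeasurable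
  rw [iIndepFun_iff_map_fun_eq_infinitePi_map hX, Measure.map_map (by fun_prop) hf]
  rw [iIndepFun_iff_map_fun_eq_infinitePi_map (by fun_prop)] at h
  refine Eq.trans h ?_
  congr 1
  ext1 i
  rw [Measure.map_map (hX i) hf]
  rfl

theorem iIndepFun_edge_binomialRandom (V : Type*) [Finite V] (p : unitInterval) :
    iIndepFun (fun (e : Sym2 V) (G : SimpleGraph V) => e ∈ G.edgeSet)
      (SimpleGraph.binomialRandom V p) := by
  rw [SimpleGraph.binomialRandom_eq_map, setBernoulli_eq_map,
    Measure.map_map (by fun_prop) (by fun_prop)]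
  refine iIndepFun_map_of_comp (by fun_prop) (fun e => by fun_prop) ?_
  -- Each edge indicator is a function of its own Bernoulli coordinate; the conjunct `¬ e.IsDiag`
  -- appears because `fromEdgeSet` discards loops.
  have := iIndepFun_infinitePi (P := fun e : Sym2 V =>
    unitInterval.toNNReal p • Measure.dirac (e ∈ (Sym2.diagSetᶜ : Set (Sym2 V))) +
      unitInterval.toNNReal (unitInterval.symm p) • Measure.dirac False)
    (X := fun e q => q ∧ ¬ e.IsDiag) (fun e => measurable_from_top)
  convert this using 1
  ext e q
  simp [SimpleGraph.edgeSet_fromEdgeSet]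

section Events

variable {V : Type*} {r : ℕ}

/-- The event `E` only depends on the presence of the coloured pairs in `I`. -/
def DeterminedBy (E : Set (RFoldGraph V r)) (I : Set (Fin r × Sym2 V)) : Prop :=
  ∀ ⦃G G' : RFoldGraph V r⦄, (∀ x ∈ I, x.2 ∈ (G x.1).edgeSet ↔ x.2 ∈ (G' x.1).edgeSet) →
    G ∈ E → G' ∈ E

namespace DeterminedBy

variable {E F : Set (RFoldGraph V r)} {I J : Set (Fin r × Sym2 V)}

theorem mono (h : DeterminedBy E I) (hIJ : I ⊆ J) : DeterminedBy E J :=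
  fun _ _ hG => h fun x hx => hG x (hIJ hx)

theorem compl (h : DeterminedBy E I) : DeterminedBy Eᶜ I :=
  fun _ _ hG h1 h2 => h1 (h (fun x hx => (hG x hx).symm) h2)

theorem inter (h : DeterminedBy E I) (h' : DeterminedBy F J) : DeterminedBy (E ∩ F) (I ∪ J) :=
  fun _ _ hG hGE => ⟨h (fun x hx => hG x (.inl hx)) hGE.1, h' (fun x hx => hG x (.inr hx)) hGE.2⟩

theorem biInter {ι : Type*} (s : Finset ι) {E : ι → Set (RFoldGraph V r)}
    {I : ι → Set (Fin r × Sym2 V)} (h : ∀ i ∈ s, DeterminedBy (E i) (I i)) :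
    DeterminedBy (⋂ i ∈ s, E i) (⋃ i ∈ s, I i) :=
  fun _ _ hG hE => Set.mem_iInter₂.2 fun i hi => h i hi
    (fun x hx => hG x (Set.mem_biUnion hi hx)) (Set.mem_iInter₂.1 hE i hi)

end DeterminedBy

theorem determinedBy_edge (i : Fin r) (u v : V) :
    DeterminedBy {G : RFoldGraph V r | (G i).Adj u v} {(i, s(u, v))} := by
  intro G G' h
  have := h (i, s(u, v)) rfl
  simpa using this.1

/-- The probability of an event under the law of the `r`-fold binomial random graph on `V`. -/
noncomputable def prob (p : Fin r → unitInterval) (E : Set (RFoldGraph V r)) : ℝ :=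
  (Measure.pi fun i => SimpleGraph.binomialRandom V (p i)).real E

theorem prob_nonneg (p : Fin r → unitInterval) (E : Set (RFoldGraph V r)) : 0 ≤ prob p E :=
  measureReal_nonneg

theorem prob_empty (p : Fin r → unitInterval) : prob p (∅ : Set (RFoldGraph V r)) = 0 := by
  simp [prob]

theorem prob_union_le (p : Fin r → unitInterval) (E F : Set (RFoldGraph V r)) :
    prob p (E ∪ F) ≤ prob p E + prob p F := measureReal_union_le _ _

theorem prob_biUnion_le {ι : Type*} (p : Fin r → unitInterval) (s : Finset ι)
    (E : ι → Set (RFoldGraph V r)) : prob p (⋃ i ∈ s, E i) ≤ ∑ i ∈ s, prob p (E i) :=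
  measureReal_biUnion_finset_le _ _

end Events

variable {V : Type*} [Finite V] {r : ℕ}

theorem iIndepFun_edge (p : Fin r → unitInterval) :
    iIndepFun (fun (x : Fin r × Sym2 V) (G : RFoldGraph V r) => x.2 ∈ (G x.1).edgeSet)
      (Measure.pi fun i => SimpleGraph.binomialRandom V (p i)) := by
  have hm : ∀ e : Sym2 V, Measurable fun (G : SimpleGraph V) => e ∈ G.edgeSet := by
    intro e; fun_prop
  refine iIndepFun_uncurry' (X := fun i e (G : RFoldGraph V r) => e ∈ (G i).edgeSet)
    (fun i e => (hm e).comp (measurable_pi_apply i)) ?_ fun i => ?_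
  · exact iIndepFun_pi (X := fun i (G : SimpleGraph V) e => e ∈ G.edgeSet)
      (fun i => (measurable_pi_lambda _ hm).aemeasurable)
  · have h := iIndepFun_edge_binomialRandom V (p i)
    rw [iIndepFun_iff_map_fun_eq_infinitePi_map hm,
      ← (measurePreserving_eval (fun i => SimpleGraph.binomialRandom V (p i)) i).map_eq,
      Measure.map_map (measurable_pi_lambda _ hm) (measurable_pi_apply i)] at h
    rw [iIndepFun_iff_map_fun_eq_infinitePi_map
      (X := fun e (G : RFoldGraph V r) => e ∈ (G i).edgeSet) (fun e => (hm e).comp (measurable_pi_apply i))]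
    refine Eq.trans h ?_
    congr 1
    ext1 e
    rw [Measure.map_map (hm e) (measurable_pi_apply i)]
    rfl

theorem binomialRandom_edge (p : unitInterval) {e : Sym2 V} (he : ¬ e.IsDiag) :
    (SimpleGraph.binomialRandom V p).real {G | e ∈ G.edgeSet} = p := by
  have hm : MeasurableSet {s : Set (Sym2 V) | e ∈ s} := measurableSet_setOfPred.2 (by fun_prop)
  have hm2 : MeasurableSet {G : SimpleGraph V | e ∈ G.edgeSet} :=
    measurableSet_setOfPred.2 (by fun_prop)
  rw [SimpleGraph.binomialRandom_eq_map, measureReal_def,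
    Measure.map_apply (by fun_prop) hm2, setBernoulli_eq_map,
    Measure.map_apply (by fun_prop) (hm2.preimage (by fun_prop))]
  have : ((fun p : Sym2 V → Prop => {i | p i}) ⁻¹'
      (SimpleGraph.fromEdgeSet ⁻¹' {G : SimpleGraph V | e ∈ G.edgeSet})) =
      (fun ω : Sym2 V → Prop => ω e) ⁻¹' {True} := by
    ext ω
    simp [SimpleGraph.edgeSet_fromEdgeSet, he]
  rw [this, ← Measure.map_apply (measurable_pi_apply e) (by measurability)]
  have h2 := Measure.infinitePi_map_eval (fun e : Sym2 V =>
    unitInterval.toNNReal p • Measure.dirac (e ∈ (Sym2.diagSetᶜ : Set (Sym2 V))) +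
      unitInterval.toNNReal (unitInterval.symm p) • Measure.dirac False) e
  rw [h2]
  simp [he]

theorem pi_binomialRandom_edge (p : Fin r → unitInterval) (i : Fin r) {e : Sym2 V}
    (he : ¬ e.IsDiag) :
    (Measure.pi fun i => SimpleGraph.binomialRandom V (p i)).real
      {G : RFoldGraph V r | e ∈ (G i).edgeSet} = p i := by
  have hm2 : MeasurableSet {G : SimpleGraph V | e ∈ G.edgeSet} :=
    measurableSet_setOfPred.2 (by fun_prop)
  have h := (measurePreserving_eval
    (fun i => SimpleGraph.binomialRandom V (p i)) i).measureReal_preimage hm2.nullMeasurableSet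
  rw [binomialRandom_edge _ he] at h
  exact h

/-- On a finite vertex set there are finitely many graphs, so this makes every event measurable. -/
instance : MeasurableSingletonClass (SimpleGraph V) where
  measurableSet_singleton _ :=
    SimpleGraph.measurableEmbedding_edgeSet.measurableSet_image.1 (Set.toFinite _).measurableSet

/-- The two events are functions of disjoint subfamilies of the independent edge indicators. -/
theorem prob_inter (p : Fin r → unitInterval) {E F : Set (RFoldGraph V r)}
    {I J : Set (Fin r × Sym2 V)} (hE : DeterminedBy E I) (hF : DeterminedBy F J)
    (hIJ : Disjoint I J) : prob p (E ∩ F) = prob p E * prob p F := by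
  classical
  have := Fintype.ofFinite V
  have hm : ∀ x : Fin r × Sym2 V, Measurable
      fun (G : RFoldGraph V r) => x.2 ∈ (G x.1).edgeSet := fun x => .of_discrete
  have h := (iIndepFun_edge (V := V) p).indepFun_finset I.toFinset J.toFinset
    (by simpa using hIJ) hm
  rw [indepFun_iff_measure_inter_preimage_eq_mul] at h
  -- An event determined by `I` is the full preimage of its image under the indicators of `I`.
  have key : ∀ {E : Set (RFoldGraph V r)} {I : Set (Fin r × Sym2 V)} , DeterminedBy E I →
      (fun (G : RFoldGraph V r) (x : I.toFinset) => x.1.2 ∈ (G x.1.1).edgeSet) ⁻¹'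
        ((fun (G : RFoldGraph V r) (x : I.toFinset) => x.1.2 ∈ (G x.1.1).edgeSet) '' E) = E := by
    intro E I hE
    refine Set.Subset.antisymm ?_ (Set.subset_preimage_image _ _)
    rintro G ⟨G', hG', hG⟩
    refine hE (fun x hx => ?_) hG'
    have := congrFun hG ⟨x, by simpa using hx⟩
    simpa using this
  have h2 := h _ _ (Set.toFinite ((fun (G : RFoldGraph V r) (x : I.toFinset) =>
      x.1.2 ∈ (G x.1.1).edgeSet) '' E)).measurableSet (Set.toFinite ((fun (G : RFoldGraph V r)
      (x : J.toFinset) => x.1.2 ∈ (G x.1.1).edgeSet) '' F)).measurableSet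
  rw [key hE, key hF] at h2
  rw [prob, prob, prob, measureReal_def, h2, ENNReal.toReal_mul]
  rfl

theorem prob_edge (p : Fin r → unitInterval) (i : Fin r) {u v : V} (h : u ≠ v) :
    prob p {G | (G i).Adj u v} = p i :=
  pi_binomialRandom_edge p i (e := s(u, v)) (by simpa using h)

theorem prob_univ (p : Fin r → unitInterval) : prob p (Set.univ : Set (RFoldGraph V r)) = 1 := by
  simp [prob]

theorem prob_mono (p : Fin r → unitInterval) {E F : Set (RFoldGraph V r)} (h : E ⊆ F) :
    prob p E ≤ prob p F := measureReal_mono h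

theorem prob_le_one (p : Fin r → unitInterval) (E : Set (RFoldGraph V r)) : prob p E ≤ 1 :=
  measureReal_le_one

theorem prob_compl (p : Fin r → unitInterval) (E : Set (RFoldGraph V r)) :
    prob p Eᶜ = 1 - prob p E := by
  rw [prob, probReal_compl_eq_one_sub .of_discrete]; rfl

theorem prob_eq_sum_fiber {ι : Type*} [Fintype ι] (p : Fin r → unitInterval)
    (E : Set (RFoldGraph V r)) (f : RFoldGraph V r → ι) :
    prob p E = ∑ i, prob p (E ∩ {G | f G = i}) := by
  classical
  simp only [prob]
  rw [← measureReal_biUnion_finset (fun i _ j _ hij => ?_) (fun _ _ => .of_discrete)]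
  · congr 1
    ext G
    simp
  · refine Set.disjoint_left.2 fun G h1 h2 => hij ?_
    rw [← h1.2, ← h2.2]

theorem prob_biInter {ι : Type*} (p : Fin r → unitInterval) (s : Finset ι)
    (E : ι → Set (RFoldGraph V r)) (I : ι → Set (Fin r × Sym2 V))
    (hE : ∀ i ∈ s, DeterminedBy (E i) (I i))
    (hI : ∀ i ∈ s, ∀ j ∈ s, i ≠ j → Disjoint (I i) (I j)) :
    prob p (⋂ i ∈ s, E i) = ∏ i ∈ s, prob p (E i) := by
  classical
  induction s using Finset.induction_on with
  | empty => simp [prob_univ]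
  | insert a s ha ih =>
    rw [Finset.prod_insert ha, Finset.set_biInter_insert,
      ← ih (fun i hi => hE i (Finset.mem_insert_of_mem hi))
        (fun i hi j hj => hI i (Finset.mem_insert_of_mem hi) j (Finset.mem_insert_of_mem hj))]
    refine prob_inter p (hE a (Finset.mem_insert_self _ _))
      (DeterminedBy.biInter s fun i hi => hE i (Finset.mem_insert_of_mem hi)) ?_
    refine Set.disjoint_iUnion₂_right.2 fun i hi => hI a (Finset.mem_insert_self _ _) i
      (Finset.mem_insert_of_mem hi) ?_
    rintro rfl
    exact ha hi

end Jigsaw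

/-! ### Vertices joined to a set in every colour -/

namespace Jigsaw

variable {V : Type*} {r : ℕ}

/-- The coloured pairs between `N` and `x` with colour in `K`. -/
def star (K : Set (Fin r)) (N : Finset V) (x : V) : Set (Fin r × Sym2 V) :=
  {y | y.1 ∈ K ∧ ∃ u ∈ N, y.2 = s(u, x)}

/-- In every colour, `x` has a neighbour in `N`. -/
def Joined (G : RFoldGraph V r) (N : Finset V) (x : V) : Prop :=
  ∀ i, ∃ u ∈ N, (G i).Adj u x

theorem disjoint_star_of_color {K K' : Set (Fin r)} (h : Disjoint K K') (N : Finset V) (x : V) :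
    Disjoint (star K N x) (star K' N x) :=
  Set.disjoint_left.2 fun _ h1 h2 => Set.disjoint_left.1 h h1.1 h2.1

theorem disjoint_star {K : Set (Fin r)} {N : Finset V} {x x' : V} (hx : x ∉ N)
    (hxx : x ≠ x') : Disjoint (star K N x) (star K N x') := by
  refine Set.disjoint_left.2 ?_
  rintro ⟨i, e⟩ ⟨_, u, hu, rfl⟩ ⟨_, u', hu', h⟩
  simp only [Sym2.eq_iff] at h
  grind

theorem determinedBy_exists_adj (i : Fin r) (N : Finset V) (x : V) :
    DeterminedBy {G : RFoldGraph V r | ∃ u ∈ N, (G i).Adj u x} (star {i} N x) := by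
  rintro G G' h ⟨u, hu, hux⟩
  have := h (i, s(u, x)) ⟨rfl, u, hu, rfl⟩
  exact ⟨u, hu, by simpa using this.1 (by simpa using hux)⟩

theorem determinedBy_joined (N : Finset V) (x : V) :
    DeterminedBy {G : RFoldGraph V r | Joined G N x} (star Set.univ N x) := by
  intro G G' h hG i
  refine determinedBy_exists_adj i N x (fun y hy => h y ⟨trivial, hy.2⟩) (hG i)

/-- The probability that a vertex is joined in every colour to a set of `k` other vertices. -/
noncomputable def joinProb (p : Fin r → unitInterval) (k : ℕ) : ℝ :=
  ∏ i, (1 - (1 - (p i : ℝ)) ^ k)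

theorem joinProb_nonneg (p : Fin r → unitInterval) (k : ℕ) : 0 ≤ joinProb p k :=
  Finset.prod_nonneg fun i _ => sub_nonneg.2
    (pow_le_one₀ (sub_nonneg.2 (p i).2.2) (sub_le_self _ (p i).2.1))

theorem joinProb_le_one (p : Fin r → unitInterval) (k : ℕ) : joinProb p k ≤ 1 :=
  Finset.prod_le_one (fun i _ => sub_nonneg.2
    (pow_le_one₀ (sub_nonneg.2 (p i).2.2) (sub_le_self _ (p i).2.1)))
    fun i _ => sub_le_self _ (pow_nonneg (sub_nonneg.2 (p i).2.2) _)

variable [Finite V]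

theorem prob_exists_adj (p : Fin r → unitInterval) (i : Fin r) {N : Finset V} {x : V}
    (hx : x ∉ N) :
    prob p {G : RFoldGraph V r | ∃ u ∈ N, (G i).Adj u x} = 1 - (1 - (p i : ℝ)) ^ N.card := by
  have h1 : {G : RFoldGraph V r | ∃ u ∈ N, (G i).Adj u x} =
      (⋂ u ∈ N, {G : RFoldGraph V r | (G i).Adj u x}ᶜ)ᶜ := by
    ext G; simp
  rw [h1, prob_compl, prob_biInter p N _ (fun u => {(i, s(u, x))})
    (fun u _ => (determinedBy_edge i u x).compl)]
  · congr 1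
    rw [← Finset.prod_const]
    refine Finset.prod_congr rfl fun u hu => ?_
    rw [prob_compl, prob_edge]
    rintro rfl
    exact hx hu
  · intro u hu v hv huv
    simp only [Set.disjoint_singleton, ne_eq, Prod.mk.injEq, true_and, Sym2.eq_iff]
    grind

theorem prob_joined (p : Fin r → unitInterval) {N : Finset V} {x : V} (hx : x ∉ N) :
    prob p {G : RFoldGraph V r | Joined G N x} = joinProb p N.card := by
  have h1 : {G : RFoldGraph V r | Joined G N x} =
      ⋂ i ∈ Finset.univ, {G : RFoldGraph V r | ∃ u ∈ N, (G i).Adj u x} := by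
    ext G; simp [Joined]
  rw [h1, prob_biInter p _ _ (fun i => star {i} N x)
    (fun i _ => determinedBy_exists_adj i N x)]
  · exact Finset.prod_congr rfl fun i _ => prob_exists_adj p i hx
  · intro i _ j _ hij
    exact disjoint_star_of_color (by simpa using hij) _ _

theorem prob_forall_not_joined (p : Fin r → unitInterval) {N B : Finset V}
    (hB : Disjoint N B) :
    prob p {G : RFoldGraph V r | ∀ x ∈ B, ¬ Joined G N x} = (1 - joinProb p N.card) ^ B.card := by
  have h1 : {G : RFoldGraph V r | ∀ x ∈ B, ¬ Joined G N x} =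
      ⋂ x ∈ B, {G : RFoldGraph V r | Joined G N x}ᶜ := by
    ext G; simp
  rw [h1, prob_biInter p _ _ (fun x => star Set.univ N x)
    (fun x _ => (determinedBy_joined N x).compl), ← Finset.prod_const]
  · refine Finset.prod_congr rfl fun x hx => ?_
    rw [prob_compl, prob_joined p (Finset.disjoint_right.1 hB hx)]
  · intro x hx y hy hxy
    exact disjoint_star (Finset.disjoint_right.1 hB hx) hxy

theorem prob_forall_exists_adj (p : Fin r → unitInterval) (i : Fin r) {N B : Finset V}
    (hB : Disjoint N B) :
    prob p {G : RFoldGraph V r | ∀ x ∈ B, ∃ u ∈ N, (G i).Adj u x} =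
      (1 - (1 - (p i : ℝ)) ^ N.card) ^ B.card := by
  have h1 : {G : RFoldGraph V r | ∀ x ∈ B, ∃ u ∈ N, (G i).Adj u x} =
      ⋂ x ∈ B, {G : RFoldGraph V r | ∃ u ∈ N, (G i).Adj u x} := by
    ext G; simp
  rw [h1, prob_biInter p _ _ (fun x => star {i} N x)
    (fun x _ => determinedBy_exists_adj i N x), ← Finset.prod_const]
  · exact Finset.prod_congr rfl fun x hx => prob_exists_adj p i (Finset.disjoint_right.1 hB hx)
  · intro x hx y hy hxy
    exact disjoint_star (Finset.disjoint_right.1 hB hx) hxy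

open Classical in
/-- Splitting a pool into `m` blocks of size `b` bounds from below the probability that at least
`m` vertices of the pool are joined to `N`. -/
theorem le_prob_card_joined (p : Fin r → unitInterval) {N W : Finset V} (hW : Disjoint N W)
    {m b : ℕ} (hmb : m * b ≤ W.card) :
    (1 - (1 - joinProb p N.card) ^ b) ^ m ≤
      prob p {G : RFoldGraph V r | m ≤ (W.filter (Joined G N)).card} := by
  obtain ⟨e⟩ : Nonempty (Fin m × Fin b ↪ W) := by
    rw [Function.Embedding.nonempty_iff_card_le]
    simpa using hmb
  let B : Fin m → Finset V := fun j => Finset.univ.image fun a => (e (j, a) : V)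
  have hBW : ∀ j, B j ⊆ W := by
    intro j x hx
    obtain ⟨a, -, rfl⟩ := Finset.mem_image.1 hx
    exact (e (j, a)).2
  have hBcard : ∀ j, (B j).card = b := by
    intro j
    rw [Finset.card_image_of_injective, Finset.card_univ, Fintype.card_fin]
    intro a a' h
    simpa using e.injective (Subtype.ext h)
  have hBdisj : ∀ j j', j ≠ j' → Disjoint (B j) (B j') := by
    intro j j' hj
    refine Finset.disjoint_left.2 fun x h1 h2 => hj ?_
    obtain ⟨a, -, rfl⟩ := Finset.mem_image.1 h1
    obtain ⟨a', -, h⟩ := Finset.mem_image.1 h2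
    have := e.injective (Subtype.ext h)
    simp only [Prod.mk.injEq] at this
    exact this.1.symm
  -- One joined vertex in each of `m` disjoint blocks suffices, and the blocks depend on disjoint
  -- stars, so these events are independent.
  have hsub : (⋂ j ∈ (Finset.univ : Finset (Fin m)),
      {G : RFoldGraph V r | ∀ x ∈ B j, ¬ Joined G N x}ᶜ) ⊆
      {G : RFoldGraph V r | m ≤ (W.filter (Joined G N)).card} := by
    intro G hG
    have : ∀ j, ∃ x ∈ B j, Joined G N x := by simpa using hG
    choose f hf hfJ using this
    have hinj : Function.Injective f := by
      intro j j' h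
      by_contra hj
      exact Finset.disjoint_left.1 (hBdisj j j' hj) (hf j) (h ▸ hf j')
    have : (Finset.univ.image f).card = m := by
      rw [Finset.card_image_of_injective _ hinj, Finset.card_univ, Fintype.card_fin]
    rw [Set.mem_ofPred_eq]
    conv_lhs => rw [← this]
    refine Finset.card_le_card fun x hx => ?_
    obtain ⟨j, -, rfl⟩ := Finset.mem_image.1 hx
    exact Finset.mem_filter.2 ⟨hBW j (hf j), hfJ j⟩
  refine le_trans (le_of_eq ?_) (prob_mono p hsub)
  have hd : ∀ j, DeterminedBy {G : RFoldGraph V r | ∀ x ∈ B j, ¬ Joined G N x}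
      (⋃ x ∈ B j, star Set.univ N x) := by
    intro j
    have := DeterminedBy.biInter (B j) fun x _ => (determinedBy_joined (r := r) N x).compl
    convert this using 1
    ext G; simp
  rw [prob_biInter p _ _ (fun j => ⋃ x ∈ B j, star Set.univ N x) (fun j _ => (hd j).compl)]
  · rw [Finset.prod_congr rfl fun j _ => by
      rw [prob_compl, prob_forall_not_joined p (hW.mono_right (hBW j)), hBcard]]
    simp
  · intro j _ j' _ hj
    refine Set.disjoint_iUnion₂_left.2 fun x hx => Set.disjoint_iUnion₂_right.2 fun y hy => ?_
    refine disjoint_star (Finset.disjoint_right.1 hW (hBW j hx)) ?_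
    rintro rfl
    exact Finset.disjoint_left.1 (hBdisj j j' hj) hx hy

end Jigsaw

/-! ### Exploring chains of doubling layers by repeated trials -/

namespace Jigsaw

variable {V : Type*} {r : ℕ}

/-- Inside `A` there is a chain of `s` further layers starting at `N`, each twice as large as the
previous one and with all its vertices joined to the previous one. -/
def Grows (G : RFoldGraph V r) : ℕ → Finset V → Finset V → Prop
  | 0, _, _ => True
  | s + 1, A, N => ∃ N' ⊆ A, N'.card = 2 * N.card ∧ (∀ x ∈ N', Joined G N x) ∧ Grows G s A N'

theorem Grows.mono {G : RFoldGraph V r} {s : ℕ} {A A' N : Finset V} (h : Grows G s A N)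
    (hA : A ⊆ A') : Grows G s A' N := by
  induction s generalizing N with
  | zero => trivial
  | succ s ih =>
    obtain ⟨N', h1, h2, h3, h4⟩ := h
    exact ⟨N', h1.trans hA, h2, h3, ih h4⟩

/-- The coloured pairs inside `A`. -/
def inside (r : ℕ) (A : Finset V) : Set (Fin r × Sym2 V) :=
  {y | ∃ u ∈ A, ∃ v ∈ A, y.2 = s(u, v)}

theorem determinedBy_grows (s : ℕ) {A N : Finset V} (hN : N ⊆ A) :
    DeterminedBy {G : RFoldGraph V r | Grows G s A N} (inside r A) := by
  induction s generalizing N with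
  | zero => exact fun _ _ _ _ => trivial
  | succ s ih =>
    rintro G G' h ⟨N', h1, h2, h3, h4⟩
    refine ⟨N', h1, h2, fun x hx => ?_, ih h1 h h4⟩
    refine determinedBy_joined N x (fun y hy => h y ?_) (h3 x hx)
    obtain ⟨_, u, hu, hy⟩ := hy
    exact ⟨u, hN hu, x, h1 hx, hy⟩

/-- No vertex of `A` is the start of a chain of `T` layers inside `A`. -/
def noSeed (r T : ℕ) (A : Finset V) : Set (RFoldGraph V r) :=
  {G | ∀ v ∈ A, ¬ Grows G T A {v}}

theorem noSeed_anti {T : ℕ} {A A' : Finset V} (h : A ⊆ A') : noSeed r T A' ⊆ noSeed r T A :=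
  fun _ hG v hv hg => hG v (h hv) (hg.mono h)

theorem determinedBy_noSeed (T : ℕ) (A : Finset V) :
    DeterminedBy (noSeed r T A) (inside r A) := by
  intro G G' h hG v hv
  exact (determinedBy_grows T (Finset.singleton_subset_iff.2 hv)).compl h (hG v hv)

variable [Fintype V]

open Classical in
-- Expose only the pairs between `N` and `W = A \ N`. If too few vertices of `W` are joined, the
-- trial has failed, but nothing inside `W` has been seen, so absence of a seed in `W` still
-- contributes a factor `Φ`. Otherwise continue inside `W` from a subset of the new layer. The size
-- hypothesis accounts for the discarded layers, of total size `2^0 + ⋯ + 2^(t-1) = 2^t - 1` with `t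
-- = T - s`.
theorem prob_not_grows_inter_noSeed_le (p : Fin r → unitInterval) (T a : ℕ) {Φ : ℝ} (hΦ0 : 0 ≤ Φ)
    (hΦ : ∀ A : Finset V, a ≤ A.card → prob p (noSeed r T A) ≤ Φ) (σ : ℕ → ℝ)
    (hσ0 : ∀ t, 0 ≤ σ t)
    (hσ : ∀ t < T, ∀ N W : Finset V, Disjoint N W → N.card = 2 ^ t → a ≤ W.card →
      σ t ≤ prob p {G : RFoldGraph V r | 2 ^ (t + 1) ≤ (W.filter (Joined G N)).card})
    (s : ℕ) (hs : s ≤ T) (A N : Finset V) (hN : N ⊆ A) (hNc : N.card = 2 ^ (T - s))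
    (hA : a + 2 ^ T ≤ A.card + 2 ^ (T - s)) :
    prob p ({G | ¬ Grows G s A N} ∩ noSeed r T A) ≤ (1 - ∏ t ∈ Finset.Ico (T - s) T, σ t) * Φ := by
  induction s generalizing A N with
  | zero => simp [Grows, prob_empty]
  | succ s ih =>
    obtain ⟨t, rfl⟩ : ∃ t, T = t + s + 1 := ⟨T - s - 1, by omega⟩
    have e1 : t + s + 1 - (s + 1) = t := by omega
    have e2 : t + s + 1 - s = t + 1 := by omega
    rw [e1] at hNc hA ⊢
    rw [e2] at ih
    have hpow : 2 * 2 ^ t ≤ 2 ^ (t + s + 1) := by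
      rw [← pow_succ']
      exact Nat.pow_le_pow_right (by norm_num) (by omega)
    set W := A \ N with hWdef
    have hWA : W ⊆ A := Finset.sdiff_subset
    have hNW : Disjoint N W := Finset.disjoint_sdiff
    have hWc : W.card + 2 ^ t = A.card := by
      rw [← hNc, hWdef, Finset.card_sdiff_add_card_eq_card hN]
    set ρ := ∏ t ∈ Finset.Ico (t + 1) (t + s + 1), σ t with hρ
    have hρ0 : 0 ≤ ρ := Finset.prod_nonneg fun _ _ => hσ0 _
    let f : RFoldGraph V r → Finset V := fun G => W.filter (Joined G N)
    have hfdet : ∀ w, DeterminedBy {G | f G = w} {y | ∃ x ∈ W, ∃ u ∈ N, y.2 = s(u, x)} := by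
      intro w G G' h hG
      rw [Set.mem_ofPred_eq] at hG ⊢
      rw [← hG]
      refine Finset.filter_congr fun x hx => ⟨fun hj => ?_, fun hj => ?_⟩
      · exact determinedBy_joined N x (fun y hy => (h y ⟨x, hx, hy.2⟩).symm) hj
      · exact determinedBy_joined N x (fun y hy => (h y ⟨x, hx, hy.2⟩)) hj
    have hdisj : Disjoint {y : Fin r × Sym2 V | ∃ x ∈ W, ∃ u ∈ N, y.2 = s(u, x)}
        (inside r W) := by
      refine Set.disjoint_left.2 ?_
      rintro ⟨i, e⟩ ⟨x, hx, u, hu, rfl⟩ ⟨v, hv, v', hv', h⟩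
      simp only [Sym2.eq_iff] at h
      have := Finset.disjoint_left.1 hNW hu
      grind
    -- One form for both cases: a large layer `w` contributes `(1 - ρ) Φ`, a small one `Φ`. Summing
    -- over `w`, the subtracted term collects the probability of a large layer, which is at least `σ
    -- t`.
    have hfib : ∀ w : Finset V,
        prob p (({G | ¬ Grows G (s + 1) A N} ∩ noSeed r (t + s + 1) A) ∩ {G | f G = w}) ≤
          Φ * prob p {G | f G = w} -
            ρ * Φ * prob p ({G | 2 ^ (t + 1) ≤ (f G).card} ∩ {G | f G = w}) := by
      intro w
      by_cases hw : w ⊆ W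
      swap
      · have : {G : RFoldGraph V r | f G = w} = ∅ :=
          Set.eq_empty_of_forall_notMem fun G hG => hw (hG ▸ Finset.filter_subset _ _)
        rw [this]; simp [prob_empty]
      by_cases hwc : 2 ^ (t + 1) ≤ w.card
      · obtain ⟨N', hN'w, hN'c⟩ := Finset.exists_subset_card_eq hwc
        have hsub : (({G | ¬ Grows G (s + 1) A N} ∩ noSeed r (t + s + 1) A) ∩ {G | f G = w}) ⊆
            {G | f G = w} ∩ ({G | ¬ Grows G s W N'} ∩ noSeed r (t + s + 1) W) := by
          rintro G ⟨⟨h1, h2⟩, h3⟩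
          refine ⟨h3, fun hg => h1 ?_, noSeed_anti hWA h2⟩
          refine ⟨N', (hN'w.trans hw).trans hWA, by rw [hN'c, hNc, pow_succ'], fun x hx => ?_,
            hg.mono hWA⟩
          have h3' : f G = w := h3
          have := h3' ▸ hN'w hx
          exact (Finset.mem_filter.1 this).2
        have e3 : {G : RFoldGraph V r | 2 ^ (t + 1) ≤ (f G).card} ∩ {G | f G = w} =
            {G | f G = w} := by
          refine Set.inter_eq_right.2 fun G hG => ?_
          have hG' : f G = w := hG
          simpa [hG'] using hwc
        rw [e3]
        refine (prob_mono p hsub).trans ?_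
        have hdet : DeterminedBy ({G : RFoldGraph V r | ¬ Grows G s W N'} ∩
            noSeed r (t + s + 1) W) (inside r W) :=
          ((determinedBy_grows s (hN'w.trans hw)).compl.inter (determinedBy_noSeed _ W)).mono
            (Set.union_self _).subset
        rw [prob_inter p (hfdet w) hdet hdisj]
        have := ih (by omega) W N' (hN'w.trans hw) hN'c (by rw [pow_succ']; omega)
        calc _ ≤ prob p {G | f G = w} * ((1 - ρ) * Φ) :=
              mul_le_mul_of_nonneg_left this (prob_nonneg _ _)
          _ = _ := by ring
      · have e3 : {G : RFoldGraph V r | 2 ^ (t + 1) ≤ (f G).card} ∩ {G | f G = w} = ∅ := by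
          refine Set.eq_empty_of_forall_notMem fun G hG => hwc ?_
          rw [← hG.2]; exact hG.1
        rw [e3, prob_empty, mul_zero, sub_zero]
        have hsub : (({G | ¬ Grows G (s + 1) A N} ∩ noSeed r (t + s + 1) A) ∩ {G | f G = w}) ⊆
            {G | f G = w} ∩ noSeed r (t + s + 1) W :=
          fun G hG => ⟨hG.2, noSeed_anti hWA hG.1.2⟩
        refine (prob_mono p hsub).trans ?_
        rw [prob_inter p (hfdet w) (determinedBy_noSeed _ W) hdisj, mul_comm]
        exact mul_le_mul_of_nonneg_right (hΦ W (by omega)) (prob_nonneg _ _)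
    have hprod : ∏ t ∈ Finset.Ico t (t + s + 1), σ t = σ t * ρ :=
      Finset.prod_eq_prod_Ico_succ_bot (by omega) σ
    rw [hprod, prob_eq_sum_fiber p _ f]
    refine (Finset.sum_le_sum fun w _ => hfib w).trans ?_
    rw [Finset.sum_sub_distrib, ← Finset.mul_sum, ← Finset.mul_sum,
      ← prob_eq_sum_fiber p _ f]
    have h1 : ∑ w, prob p {G : RFoldGraph V r | f G = w} = 1 := by
      rw [← prob_univ (V := V) p, prob_eq_sum_fiber p _ f]
      simp
    have h2 := hσ t (by omega) N W hNW hNc (by omega)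
    rw [h1]
    have h3 : ρ * Φ * σ t ≤ ρ * Φ * prob p {G : RFoldGraph V r | 2 ^ (t + 1) ≤ (f G).card} :=
      mul_le_mul_of_nonneg_left h2 (mul_nonneg hρ0 hΦ0)
    linarith

open Classical in
/-- If each layer succeeds with probability at least `σ t` whenever `a` fresh vertices are
available, then, in a set with room for `j` trials, all of them fail with probability at most
`(1 - ∏ σ t) ^ j`. -/
theorem prob_noSeed_le (p : Fin r → unitInterval) (T a : ℕ) (σ : ℕ → ℝ)
    (hσ0 : ∀ t, 0 ≤ σ t) (hσ1 : ∀ t, σ t ≤ 1)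
    (hσ : ∀ t < T, ∀ N W : Finset V, Disjoint N W → N.card = 2 ^ t → a ≤ W.card →
      σ t ≤ prob p {G : RFoldGraph V r | 2 ^ (t + 1) ≤ (W.filter (Joined G N)).card})
    (j : ℕ) (A : Finset V) (hA : a + j * 2 ^ T ≤ A.card) :
    prob p (noSeed r T A) ≤ (1 - ∏ t ∈ Finset.range T, σ t) ^ j := by
  have hρ1 : ∏ t ∈ Finset.range T, σ t ≤ 1 :=
    Finset.prod_le_one (fun _ _ => hσ0 _) fun _ _ => hσ1 _
  induction j generalizing A with
  | zero => simpa using prob_le_one p _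
  | succ j ih =>
    have hT : 0 < 2 ^ T := by positivity
    have e : a + j * 2 ^ T + 2 ^ T = a + (j + 1) * 2 ^ T := by ring
    obtain ⟨v, hv⟩ : A.Nonempty := Finset.card_pos.1 (by omega)
    -- The trial at `v` uses fewer than `2 ^ T` vertices, leaving room for the other `j` trials,
    -- whose bound plays the role of `Φ`.
    have := prob_not_grows_inter_noSeed_le (V := V) p T (a + j * 2 ^ T)
      (pow_nonneg (sub_nonneg.2 hρ1) j) ih σ hσ0
      (fun t ht N W h1 h2 h3 => hσ t ht N W h1 h2 (by omega)) T le_rfl A {v}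
      (Finset.singleton_subset_iff.2 hv) (by simp) (by rw [Nat.sub_self]; omega)
    rw [Nat.sub_self, Nat.Ico_zero_eq_range, ← pow_succ'] at this
    have hsub : noSeed r T A ⊆ {G | ¬ Grows G T A {v}} ∩ noSeed r T A :=
      fun G hG => ⟨hG v hv, hG⟩
    exact (prob_mono p hsub).trans this

end Jigsaw

/-! ### Deterministic facts about the process -/

namespace Jigsaw

variable {V : Type*} {r : ℕ}

theorem le_step (G : RFoldGraph V r) (s : Setoid V) : s ≤ step G s := by
  intro x y h
  have : Quotient.mk s x = Quotient.mk s y := Quotient.sound h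
  change (clusterGraph G s).Reachable _ _
  rw [this]

theorem not_adj_of_step_eq {G : RFoldGraph V r} {s : Setoid V} (h : step G s = s)
    (a b : Quotient s) : ¬ (clusterGraph G s).Adj a b := by
  induction a using Quotient.inductionOn with | _ x =>
  induction b using Quotient.inductionOn with | _ y =>
  intro hab
  refine hab.1 (Quotient.sound ?_)
  have : step G s x y := hab.reachable
  rwa [h] at this

theorem exists_step_eq [Finite V] (G : RFoldGraph V r) :
    ∃ t, step G (partition G t) = partition G t := by
  have : Finite (Setoid V) :=
    Finite.of_injective (fun s : Setoid V => fun x y => s x y)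
      fun s s' h => Setoid.ext fun x y => iff_of_eq (congrFun (congrFun h x) y)
  obtain ⟨t, ht⟩ := WellFoundedGT.monotone_chain_condition
    (⟨partition G, monotone_nat_of_le_succ fun t => le_step G _⟩ : ℕ →o Setoid V)
  exact ⟨t, (ht (t + 1) (Nat.le_succ t)).symm⟩

/-- Being joined to part of a cluster makes two distinct clusters adjacent, which a stable partition
forbids. -/
theorem Joined.rel_of_step_eq {G : RFoldGraph V r} {s : Setoid V} (h : step G s = s)
    {N : Finset V} {c x : V} (hN : ∀ u ∈ N, s u c) (hx : Joined G N x) : s x c := by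
  by_contra hxc
  refine not_adj_of_step_eq h (Quotient.mk s c) (Quotient.mk s x) ⟨fun he => hxc ?_, fun i => ?_⟩
  · exact s.symm (Quotient.exact he)
  · obtain ⟨u, hu, hux⟩ := hx i
    exact ⟨u, x, Quotient.sound (hN u hu), rfl, hux⟩

theorem Grows.exists_rel_of_step_eq {G : RFoldGraph V r} {s : Setoid V} (h : step G s = s)
    {k : ℕ} {A N : Finset V} {c : V} (hN : ∀ u ∈ N, s u c) (hg : Grows G k A N) :
    ∃ S : Finset V, (∀ u ∈ S, s u c) ∧ S.card = 2 ^ k * N.card := by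
  induction k generalizing N with
  | zero => exact ⟨N, hN, by simp⟩
  | succ k ih =>
    obtain ⟨N', -, h2, h3, h4⟩ := hg
    obtain ⟨S, hS, hc⟩ := ih (fun x hx => (h3 x hx).rel_of_step_eq h hN) h4
    exact ⟨S, hS, by rw [hc, h2]; ring⟩

/-- A long chain of doubling layers, together with the fact that every large set of vertices has
a vertex joined to it from outside, makes the process percolate. -/
theorem percolates_of_grows [Fintype V] {G : RFoldGraph V r} {T : ℕ} {v : V}
    (hv : Grows G T Finset.univ {v})
    (hG : ∀ S : Finset V, 2 ^ T ≤ S.card → S ≠ Finset.univ → ∃ x ∉ S, Joined G S x) :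
    Percolates G := by
  classical
  obtain ⟨t, ht⟩ := exists_step_eq G
  refine ⟨t, ?_⟩
  set s := partition G t
  obtain ⟨S, hS, hSc⟩ := hv.exists_rel_of_step_eq ht (c := v)
    (fun u hu => by rw [Finset.mem_singleton.1 hu])
  set C := Finset.univ.filter fun u => s u v with hC
  have hSC : S ⊆ C := fun u hu => by simpa [hC] using hS u hu
  have hCu : C = Finset.univ := by
    by_contra hne
    obtain ⟨x, hx, hj⟩ := hG C
      (le_trans (by simp [hSc]) (Finset.card_le_card hSC)) hne
    exact hx (by simpa [hC] using hj.rel_of_step_eq ht (c := v) fun u hu => by simpa [hC] using hu)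
  have hall : ∀ x, s x v := fun x => by
    have := Finset.mem_univ x
    rw [← hCu] at this
    simpa [hC] using this
  rw [Nat.card_eq_one_iff_unique]
  refine ⟨⟨fun a b => ?_⟩, ⟨Quotient.mk s v⟩⟩
  induction a using Quotient.inductionOn with | _ x =>
  induction b using Quotient.inductionOn with | _ y =>
  exact Quotient.sound (s.trans (hall x) (s.symm (hall y)))

theorem Percolates.exists_rel {G : RFoldGraph V r} (h : Percolates G) :
    Nonempty V ∧ ∃ t, ∀ x y, partition G t x y := by
  obtain ⟨t, ht⟩ := h
  rw [Nat.card_eq_one_iff_unique] at ht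
  obtain ⟨h1, ⟨a⟩⟩ := ht
  exact ⟨⟨a.out⟩, t, fun x y => Quotient.exact (Subsingleton.elim _ _)⟩

/-- The cluster of `v` stays `{v}` forever: any auxiliary edge at it would require an edge of colour
`i` at `v`. -/
theorem not_percolates_of_isolated [Nontrivial V] {G : RFoldGraph V r} {i : Fin r} {v : V}
    (hv : ∀ u, ¬ (G i).Adj v u) : ¬ Percolates G := by
  intro h
  obtain ⟨-, t, ht⟩ := h.exists_rel
  have key : ∀ t u, partition G t u v → u = v := by
    intro t
    induction t with
    | zero => exact fun u hu => hu
    | succ t ih =>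
      intro u hu
      obtain ⟨w⟩ : (clusterGraph G (partition G t)).Reachable
        (Quotient.mk _ v) (Quotient.mk _ u) := SimpleGraph.Reachable.symm hu
      have : ∀ b, (clusterGraph G (partition G t)).Walk (Quotient.mk _ v) b →
          b = Quotient.mk _ v := by
        intro b w
        cases w with
        | nil => rfl
        | cons hab _ =>
          obtain ⟨x, y, hx, -, hxy⟩ := hab.2 i
          rw [ih x (Quotient.exact hx)] at hxy
          exact absurd hxy (hv y)
      exact ih u (Quotient.exact (this _ w))
  obtain ⟨u, hu⟩ := exists_ne v
  exact hu (key t u (ht u v))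

/-- `S` induces a connected graph in every colour. -/
def ConnectedIn (G : RFoldGraph V r) (S : Finset V) : Prop :=
  ∀ i, ((G i).induce (S : Set V)).Connected

theorem connectedIn_singleton (G : RFoldGraph V r) (x : V) : ConnectedIn G {x} := by
  intro i
  rw [Finset.coe_singleton]
  have : Subsingleton ({x} : Set V) := inferInstance
  have : Nonempty ({x} : Set V) := ⟨⟨x, rfl⟩⟩
  exact ⟨.of_subsingleton⟩

/-- Sizes cannot jump over the window `[m, 2m]`. Joining two adjacent clusters, each connected in
every colour and smaller than `m`, gives a set connected in every colour and smaller than `2m`,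
hence smaller than `m` again. -/
theorem card_partition_class_lt [Fintype V] [DecidableEq V] {G : RFoldGraph V r} {m : ℕ}
    (hm : 1 ≤ m) (hG : ∀ S : Finset V, m ≤ S.card → S.card ≤ 2 * m → ¬ ConnectedIn G S) (t : ℕ)
    (x : V) {S : Finset V} (hS : ∀ u, u ∈ S ↔ partition G t u x) :
    ConnectedIn G S ∧ S.card < m := by
  classical
  have hlt : ∀ S : Finset V, ConnectedIn G S → S.card ≤ 2 * m → S.card < m := by
    intro S h1 h2
    by_contra h3
    exact hG S (by omega) h2 h1
  induction t generalizing x S with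
  | zero =>
    have : S = {x} := by
      ext u
      rw [hS, Finset.mem_singleton]
      rfl
    subst this
    exact ⟨connectedIn_singleton G x, hlt _ (connectedIn_singleton G x) (by simp; omega)⟩
  | succ t ih =>
    set s := partition G t with hs
    let U : Finset (Quotient s) → Finset V :=
      fun D => Finset.univ.filter fun u => Quotient.mk s u ∈ D
    have hUs : ∀ y, ConnectedIn G (U {Quotient.mk s y}) ∧ (U {Quotient.mk s y}).card < m := by
      intro y
      refine ih y fun u => ?_
      simp only [U, Finset.mem_filter, Finset.mem_univ, true_and, Finset.mem_singleton]
      exact Quotient.eq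
    -- A single step may merge many clusters at once. A maximal family in `F` must be the whole
    -- component, since a neighbouring cluster could otherwise be added.
    let F : Finset (Finset (Quotient s)) := Finset.univ.filter fun D =>
      Quotient.mk s x ∈ D ∧ (∀ b ∈ D, (clusterGraph G s).Reachable b (Quotient.mk s x)) ∧
        ConnectedIn G (U D) ∧ (U D).card < m
    have hF : F.Nonempty := by
      refine ⟨{Quotient.mk s x}, ?_⟩
      simp only [F, Finset.mem_filter, Finset.mem_univ, true_and, Finset.mem_singleton]
      exact ⟨fun b hb => hb ▸ .rfl, hUs x⟩
    obtain ⟨D, hD⟩ := F.exists_maximal hF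
    obtain ⟨hxD, hDr, hDc, hDm⟩ : _ ∧ _ ∧ _ ∧ _ := by
      simpa only [F, Finset.mem_filter, Finset.mem_univ, true_and] using hD.prop
    have hSU : S = U D := by
      ext u
      rw [hS]
      simp only [U, Finset.mem_filter, Finset.mem_univ, true_and]
      refine ⟨fun hu => ?_, fun hu => hDr _ hu⟩
      by_contra huD
      obtain ⟨w⟩ : (clusterGraph G s).Reachable (Quotient.mk _ x) (Quotient.mk _ u) :=
        SimpleGraph.Reachable.symm hu
      obtain ⟨d, -, hd1, hd2⟩ := w.exists_boundary_dart (D : Set (Quotient s)) hxD huD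
      obtain ⟨⟨a, b⟩, hab⟩ := d
      simp only [Finset.mem_coe] at hd1 hd2
      have hUi : U (insert b D) = U D ∪ U {b} := by
        ext z
        simp only [U, Finset.mem_filter, Finset.mem_univ, true_and, Finset.mem_insert,
          Finset.mem_singleton, Finset.mem_union]
        exact or_comm
      obtain ⟨hb1, hb2⟩ : ConnectedIn G (U {b}) ∧ (U {b}).card < m := by
        rw [← Quotient.out_eq b]; exact hUs _
      have hconn : ConnectedIn G (U (insert b D)) := by
        intro i
        obtain ⟨y, z, hy, hz, hyz⟩ := hab.2 i
        rw [hUi, Finset.coe_union]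
        exact SimpleGraph.connected_induce_union (hDc i).preconnected (hb1 i).preconnected (v := y) (w := z)
          (by simpa [U, hy] using hd1) (by simp [U, hz]) hyz
      have hins : insert b D ∈ F := by
        simp only [F, Finset.mem_filter, Finset.mem_univ, true_and]
        refine ⟨Finset.mem_insert_of_mem hxD, ?_, hconn, hlt _ hconn ?_⟩
        · intro c hc
          rcases Finset.mem_insert.1 hc with rfl | hc
          · exact hab.symm.reachable.trans (hDr a hd1)
          · exact hDr c hc
        · rw [hUi]
          exact (Finset.card_union_le _ _).trans (by omega)
      exact hd2 (hD.le_of_ge hins (Finset.subset_insert _ _) (Finset.mem_insert_self _ _))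
    rw [hSU]
    exact ⟨hDc, hDm⟩

/-- If the process percolates then, at every scale `m`, some set of between `m` and `2 * m`
vertices induces a connected graph in every colour. -/
theorem Percolates.exists_connectedIn [Fintype V] {G : RFoldGraph V r} (h : Percolates G) {m : ℕ}
    (hm : 1 ≤ m) (hmV : m ≤ Fintype.card V) :
    ∃ S : Finset V, m ≤ S.card ∧ S.card ≤ 2 * m ∧ ConnectedIn G S := by
  classical
  by_contra! hG
  obtain ⟨⟨x⟩, t, ht⟩ := h.exists_rel
  have := (card_partition_class_lt hm hG t x (S := Finset.univ) fun u => by simp [ht u x]).2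
  rw [Finset.card_univ] at this
  omega

end Jigsaw

/-! ### Probability that a set is connected in several colours -/

namespace Jigsaw

variable {V : Type*} {r : ℕ}

/-- A connected graph has a parent function towards any root, with distinct parent edges. -/
theorem exists_parent {W : Type*} {H : SimpleGraph W} (hH : H.Connected) (a : W) :
    ∃ f : {v // v ≠ a} → W, (∀ v, H.Adj v.1 (f v)) ∧
      Function.Injective fun v : {v // v ≠ a} => s(v.1, f v) := by
  -- The parent is the next vertex on a geodesic to `a`. Strictly decreasing distance prevents two
  -- vertices from being each other's parent.
  have : ∀ v : {v // v ≠ a}, ∃ w, H.Adj v w ∧ H.dist w a < H.dist v a := by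
    rintro ⟨v, hv⟩
    obtain ⟨w, hw⟩ := hH.exists_walk_length_eq_dist v a
    cases w with
    | nil => exact absurd rfl hv
    | @cons _ b _ hab w' =>
      refine ⟨b, hab, ?_⟩
      have := SimpleGraph.dist_le w'
      rw [SimpleGraph.Walk.length_cons] at hw
      simp only
      omega
  choose f hf hd using this
  refine ⟨f, hf, ?_⟩
  intro v w hvw
  rcases Sym2.eq_iff.1 hvw with ⟨h, -⟩ | ⟨h1, h2⟩
  · exact Subtype.ext h
  · have hv := hd v
    have hw := hd w
    rw [h2] at hv
    rw [← h1] at hw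
    omega

theorem determinedBy_connected_induce (i : Fin r) (S : Set V) :
    DeterminedBy {G : RFoldGraph V r | ((G i).induce S).Connected} {y | y.1 = i} := by
  intro G G' h hG
  have : G i = G' i := SimpleGraph.edgeSet_injective (Set.ext fun e => h (i, e) rfl)
  rw [Set.mem_ofPred_eq, ← this]
  exact hG

variable [Finite V]

/-- Union bound over the at most `|S|^(|S|-1)` parent functions. The parent edges are distinct, so
each function is realised with probability `p_i^(|S|-1)`. -/
theorem prob_connected_induce_le (p : Fin r → unitInterval) (i : Fin r) {S : Finset V}
    (hS : S.Nonempty) :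
    prob p {G : RFoldGraph V r | ((G i).induce (S : Set V)).Connected} ≤
      (S.card * (p i : ℝ)) ^ (S.card - 1) := by
  classical
  obtain ⟨a, ha⟩ := hS
  let a' : (S : Set V) := ⟨a, ha⟩
  let good : Finset ({v : (S : Set V) // v ≠ a'} → (S : Set V)) := Finset.univ.filter fun f =>
    (∀ v, v.1 ≠ f v) ∧
      Function.Injective fun v : {v : (S : Set V) // v ≠ a'} => s(v.1, f v)
  let E : ({v : (S : Set V) // v ≠ a'} → (S : Set V)) → Set (RFoldGraph V r) := fun f =>
    ⋂ v ∈ (Finset.univ : Finset {v : (S : Set V) // v ≠ a'}), {G | (G i).Adj v.1 (f v)}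
  have hsub : {G : RFoldGraph V r | ((G i).induce (S : Set V)).Connected} ⊆ ⋃ f ∈ good, E f := by
    intro G hG
    obtain ⟨f, hf, hinj⟩ := exists_parent hG a'
    refine Set.mem_biUnion (x := f) ?_ ?_
    · simp only [good, Finset.coe_filter, Finset.mem_univ, true_and, Set.mem_ofPred_eq]
      exact ⟨fun v => (hf v).ne, hinj⟩
    · simp only [E, Set.mem_iInter]
      exact fun v _ => hf v
  have hcard : Fintype.card {v : (S : Set V) // v ≠ a'} = S.card - 1 := by
    rw [Fintype.card_subtype_compl, Fintype.card_subtype_eq]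
    simp
  have hE : ∀ f ∈ good, prob p (E f) ≤ (p i : ℝ) ^ (S.card - 1) := by
    intro f hf
    simp only [good, Finset.mem_filter, Finset.mem_univ, true_and] at hf
    rw [prob_biInter p _ _ (fun v => {(i, s(v.1.1, (f v).1))})
      (fun v _ => determinedBy_edge i v.1.1 (f v).1)]
    · rw [← hcard, ← Finset.card_univ, ← Finset.prod_const]
      refine le_of_eq (Finset.prod_congr rfl fun v _ => prob_edge p i ?_)
      exact fun h => hf.1 v (Subtype.ext h)
    · intro v _ w _ hvw
      simp only [Set.disjoint_singleton, ne_eq, Prod.mk.injEq, true_and]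
      refine fun h => hvw (hf.2 ?_)
      rw [Sym2.eq_iff] at h
      exact Sym2.eq_iff.2 (h.imp (fun h => ⟨Subtype.ext h.1, Subtype.ext h.2⟩)
        fun h => ⟨Subtype.ext h.1, Subtype.ext h.2⟩)
  calc _ ≤ prob p (⋃ f ∈ good, E f) := prob_mono p hsub
    _ ≤ ∑ f ∈ good, prob p (E f) := prob_biUnion_le p good E
    _ ≤ ∑ f ∈ good, (p i : ℝ) ^ (S.card - 1) := Finset.sum_le_sum hE
    _ = good.card * (p i : ℝ) ^ (S.card - 1) := by rw [Finset.sum_const, nsmul_eq_mul]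
    _ ≤ (S.card : ℝ) ^ (S.card - 1) * (p i : ℝ) ^ (S.card - 1) := by
        refine mul_le_mul_of_nonneg_right ?_ (pow_nonneg (p i).2.1 _)
        have : good.card ≤ S.card ^ (S.card - 1) := by
          refine (Finset.card_le_univ _).trans (le_of_eq ?_)
          rw [Fintype.card_fun, hcard]
          simp
        exact_mod_cast this
    _ = _ := (mul_pow _ _ _).symm

theorem prob_connectedIn_le (p : Fin r → unitInterval) {S : Finset V} (hS : S.Nonempty) {j : ℕ}
    (hj : j ≤ r) :
    prob p {G : RFoldGraph V r | ConnectedIn G S} ≤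
      ((S.card : ℝ) ^ j * prefixProd p j) ^ (S.card - 1) := by
  classical
  have hsub : {G : RFoldGraph V r | ConnectedIn G S} ⊆
      ⋂ i ∈ (Finset.univ.filter fun i : Fin r => i.val < j),
        {G : RFoldGraph V r | ((G i).induce (S : Set V)).Connected} := by
    intro G hG
    simp only [Set.mem_iInter]
    exact fun i _ => hG i
  refine (prob_mono p hsub).trans ?_
  rw [prob_biInter p _ _ (fun i => {y | y.1 = i}) (fun i _ => determinedBy_connected_induce i _)]
  · refine (Finset.prod_le_prod (fun i _ => prob_nonneg p _)
      fun i _ => prob_connected_induce_le p i hS).trans (le_of_eq ?_)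
    rw [Finset.prod_pow, Finset.prod_mul_distrib, Finset.prod_const, prefixProd,
      Fin.card_filter_val_lt, min_eq_right hj]
  · intro i _ i' _ h
    exact Set.disjoint_left.2 fun y h1 h2 => h (h1.symm.trans h2)

end Jigsaw

/-! ### Union bounds below the threshold -/

namespace Jigsaw

variable {r : ℕ}

theorem choose_le_div_pow (n k : ℕ) (hk : 1 ≤ k) :
    (n.choose k : ℝ) ≤ (n * Real.exp 1 / k) ^ k := by
  have h1 : (n.choose k : ℝ) ≤ (n : ℝ) ^ k / k.factorial := Nat.choose_le_pow_div k n
  have h2 : (k : ℝ) ^ k / k.factorial ≤ Real.exp k :=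
    Real.pow_div_factorial_le_exp (k : ℝ) (Nat.cast_nonneg k) k
  have hk0 : (0 : ℝ) < k := by exact_mod_cast hk
  have hf : (0 : ℝ) < k.factorial := by exact_mod_cast k.factorial_pos
  rw [div_le_iff₀ hf] at h2
  refine h1.trans ?_
  rw [div_pow, mul_pow, ← Real.exp_nat_mul, mul_one, div_le_div_iff₀ hf (by positivity), mul_assoc]
  exact mul_le_mul_of_nonneg_left h2 (by positivity)

theorem prefixProd_nonneg (p : Fin r → unitInterval) (i : ℕ) : 0 ≤ prefixProd p i :=
  Finset.prod_nonneg fun j _ => (p j).2.1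

theorem prob_exists_connectedIn_le (n : ℕ) (p : Fin r → unitInterval) {j : ℕ} (hj : j ≤ r)
    {m : ℕ} (hm : 1 ≤ m) :
    prob p {G : RFoldGraph (Fin n) r | ∃ S : Finset (Fin n), m ≤ S.card ∧ S.card ≤ 2 * m ∧
      ConnectedIn G S} ≤
      ∑ k ∈ Finset.Icc m (2 * m), (n.choose k : ℝ) * ((k : ℝ) ^ j * prefixProd p j) ^ (k - 1) := by
  classical
  have hsub : {G : RFoldGraph (Fin n) r | ∃ S : Finset (Fin n), m ≤ S.card ∧ S.card ≤ 2 * m ∧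
      ConnectedIn G S} ⊆ ⋃ k ∈ Finset.Icc m (2 * m),
        ⋃ S ∈ (Finset.univ : Finset (Fin n)).powersetCard k, {G | ConnectedIn G S} := by
    rintro G ⟨S, h1, h2, h3⟩
    refine Set.mem_biUnion (x := S.card) (by simp [h1, h2]) ?_
    exact Set.mem_biUnion (x := S) (by simp) h3
  refine (prob_mono p hsub).trans ((prob_biUnion_le p _ _).trans ?_)
  refine Finset.sum_le_sum fun k hk => (prob_biUnion_le p _ _).trans ?_
  have hk1 := (Finset.mem_Icc.1 hk).1
  refine (Finset.sum_le_card_nsmul _ _ (((k : ℝ) ^ j * prefixProd p j) ^ (k - 1))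
    fun S hS => ?_).trans (le_of_eq ?_)
  · have hSc := (Finset.mem_powersetCard.1 hS).2
    rw [← hSc]
    exact prob_connectedIn_le p (Finset.card_pos.1 (by omega)) hj
  · rw [Finset.card_powersetCard, nsmul_eq_mul, Finset.card_univ, Fintype.card_fin]

theorem choose_mul_pow_le {n k j : ℕ} {C P : ℝ} (hn : 3 ≤ n) (hj1 : 1 ≤ j) (hjr : j ≤ r)
    (hC : Real.exp 4 * 4 ^ r ≤ C) (hP0 : 0 ≤ P)
    (hP : P ≤ 1 / (C * n * Real.log n ^ (j - 1))) (hk1 : Real.log n ≤ k)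
    (hk2 : k ≤ 4 * Real.log n) :
    (n.choose k : ℝ) * ((k : ℝ) ^ j * P) ^ (k - 1) ≤ Real.exp 4 / n ^ 2 := by
  have hn0 : (0 : ℝ) < n := by positivity
  have hC0 : 0 < C := lt_of_lt_of_le (by positivity) hC
  set L := Real.log n with hL
  have hL1 : 1 ≤ L := by
    rw [hL, Real.le_log_iff_exp_le hn0]
    exact Real.exp_one_lt_three.le.trans (by exact_mod_cast hn)
  have hkR : (1 : ℝ) ≤ k := hL1.trans hk1
  have hk : 1 ≤ k := by exact_mod_cast hkR
  have hk0 : (0 : ℝ) < k := by linarith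
  obtain ⟨k, rfl⟩ : ∃ l, k = l + 1 := ⟨k - 1, by omega⟩
  obtain ⟨j, rfl⟩ : ∃ l, j = l + 1 := ⟨j - 1, by omega⟩
  set K : ℝ := ((k + 1 : ℕ) : ℝ) with hK
  simp only [Nat.add_sub_cancel] at hP ⊢
  -- With `k ≥ log n`, the power `k - 1` of `e^(-3)` is at most `e^3 / n^3`, which beats the one
  -- factor `n e` left over from the binomial coefficient.
  have hbase : n * Real.exp 1 * K ^ j * P ≤ Real.exp (-3) := by
    have h1 : K ^ j ≤ (4 * L) ^ j := pow_le_pow_left₀ hk0.le hk2 _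
    calc n * Real.exp 1 * K ^ j * P
        ≤ n * Real.exp 1 * (4 * L) ^ j * (1 / (C * n * L ^ j)) := by gcongr
      _ = Real.exp 1 * 4 ^ j / C := by
          have : L ≠ 0 := by positivity
          rw [mul_pow]
          field_simp
      _ ≤ Real.exp 1 * 4 ^ r / (Real.exp 4 * 4 ^ r) := by
          gcongr
          · norm_num
          · omega
      _ = Real.exp 1 / Real.exp 4 := by field_simp
      _ = Real.exp (-3) := by rw [← Real.exp_sub]; norm_num
  calc (n.choose (k + 1) : ℝ) * (K ^ (j + 1) * P) ^ k
      ≤ (n * Real.exp 1 / K) ^ (k + 1) * (K ^ (j + 1) * P) ^ k := by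
        gcongr
        exact choose_le_div_pow n (k + 1) hk
    _ = n * Real.exp 1 / K * (n * Real.exp 1 * K ^ j * P) ^ k := by
        have : n * Real.exp 1 * K ^ j * P = n * Real.exp 1 / K * (K ^ (j + 1) * P) := by
          rw [pow_succ]
          field_simp
        rw [this, mul_pow (n * Real.exp 1 / K), pow_succ']
        ring
    _ ≤ n * Real.exp 1 * Real.exp (-3) ^ k := by
        gcongr
        exact div_le_self (by positivity) hkR
    _ ≤ n * Real.exp 1 * Real.exp (-3 * L + 3) := by
        gcongr
        rw [← Real.exp_nat_mul, Real.exp_le_exp]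
        have : K = k + 1 := by simp [hK]
        linarith
    _ = Real.exp 4 / n ^ 2 := by
        have h3 : Real.exp (-3 * L + 3) = Real.exp 3 / n ^ 3 := by
          rw [Real.exp_add, show -3 * L = -(((3 : ℕ) : ℝ) * L) by push_cast; ring, Real.exp_neg,
            Real.exp_nat_mul, hL, Real.exp_log hn0]
          field_simp
        have h4 : Real.exp 4 = Real.exp 1 * Real.exp 3 := by rw [← Real.exp_add]; norm_num
        rw [h3, h4]
        field_simp

/-- If one of the products `P_j` with `j ≥ 2` is small, percolation is unlikely. -/
theorem prob_percolates_le_of_prefixProd_le {n j : ℕ} {C : ℝ} (p : Fin r → unitInterval)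
    (hn : 3 ≤ n) (hj1 : 1 ≤ j) (hjr : j ≤ r) (hC : Real.exp 4 * 4 ^ r ≤ C)
    (hP : prefixProd p j ≤ 1 / (C * n * Real.log n ^ (j - 1))) :
    prob p {G : RFoldGraph (Fin n) r | Percolates G} ≤ 2 * Real.exp 4 / n := by
  have hn0 : (0 : ℝ) < n := by positivity
  set m := ⌈Real.log n⌉₊ with hm
  have hL1 : 1 ≤ Real.log n := by
    rw [Real.le_log_iff_exp_le hn0]
    exact Real.exp_one_lt_three.le.trans (by exact_mod_cast hn)
  have hm1 : 1 ≤ m := Nat.one_le_ceil_iff.2 (by linarith)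
  have hmn : m + 1 ≤ n := by
    have : Real.log n ≤ (n - 1 : ℕ) := by
      rw [Nat.cast_sub (by omega), Nat.cast_one]
      exact Real.log_le_sub_one_of_pos hn0
    have := Nat.ceil_le.2 this
    omega
  have hmL : (m : ℝ) ≤ 2 * Real.log n := by
    have := Nat.ceil_lt_add_one (a := Real.log n) (by linarith)
    linarith
  have hsub : {G : RFoldGraph (Fin n) r | Percolates G} ⊆
      {G : RFoldGraph (Fin n) r | ∃ S : Finset (Fin n), m ≤ S.card ∧ S.card ≤ 2 * m ∧
        ConnectedIn G S} :=
    fun G hG => hG.exists_connectedIn hm1 (by rw [Fintype.card_fin]; omega)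
  refine (prob_mono p hsub).trans ((prob_exists_connectedIn_le n p hjr hm1).trans ?_)
  refine (Finset.sum_le_card_nsmul _ _ (Real.exp 4 / n ^ 2) fun k hk => ?_).trans ?_
  · obtain ⟨h1, h2⟩ := Finset.mem_Icc.1 hk
    refine choose_mul_pow_le hn hj1 hjr hC (prefixProd_nonneg p j) hP ?_ ?_
    · exact (Nat.le_ceil _).trans (by exact_mod_cast h1)
    · have : (k : ℝ) ≤ 2 * m := by exact_mod_cast h2
      linarith
  · rw [Nat.card_Icc, nsmul_eq_mul]
    have h1 : ((2 * m + 1 - m : ℕ) : ℝ) ≤ 2 * n := by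
      have : 2 * m + 1 - m ≤ 2 * n := by omega
      exact_mod_cast this
    calc _ ≤ 2 * n * (Real.exp 4 / n ^ 2) := by gcongr
      _ = _ := by field_simp

/-- If `W` spans no edge of colour `i`, a vertex of `W` without neighbours outside `W` is isolated.
The stars from `W` to its complement are independent, so no second moment is needed. -/
theorem prob_percolates_le_of_isolated {n : ℕ} (hn : 2 ≤ n) (p : Fin r → unitInterval) (i : Fin r)
    (W : Finset (Fin n)) :
    prob p {G : RFoldGraph (Fin n) r | Percolates G} ≤
      W.card ^ 2 * (p i : ℝ) + Real.exp (-(W.card * (1 - (p i : ℝ)) ^ n)) := by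
  classical
  have : Nontrivial (Fin n) := Fin.nontrivial_iff_two_le.2 hn
  have hp0 := (p i).2.1
  have hp1 := (p i).2.2
  have hsub : {G : RFoldGraph (Fin n) r | Percolates G} ⊆
      (⋃ e ∈ W.offDiag, {G | (G i).Adj e.1 e.2}) ∪
        {G | ∀ x ∈ W, ∃ u ∈ Wᶜ, (G i).Adj u x} := by
    intro G hG
    by_contra hcon
    simp only [Set.mem_union, Set.mem_iUnion, Finset.mem_offDiag, Set.mem_ofPred_eq, not_or,
      not_exists, not_forall, not_and, Prod.forall, Finset.mem_compl] at hcon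
    obtain ⟨h1, x, hx, h2⟩ := hcon
    refine not_percolates_of_isolated (i := i) (v := x) (fun u hu => ?_) hG
    by_cases huW : u ∈ W
    · exact h1 x u ⟨hx, huW, hu.ne⟩ hu
    · exact h2 u huW hu.symm
  refine (prob_mono p hsub).trans ((prob_union_le p _ _).trans (add_le_add ?_ ?_))
  · refine (prob_biUnion_le p _ _).trans ?_
    rw [Finset.sum_congr rfl fun e he => prob_edge p i (Finset.mem_offDiag.1 he).2.2,
      Finset.sum_const, nsmul_eq_mul, Finset.offDiag_card]
    refine mul_le_mul_of_nonneg_right ?_ hp0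
    have : W.card * W.card - W.card ≤ W.card ^ 2 := by rw [sq]; omega
    exact_mod_cast this
  · rw [prob_forall_exists_adj p i disjoint_compl_left]
    have hle : (1 - (p i : ℝ)) ^ n ≤ (1 - (p i : ℝ)) ^ Wᶜ.card :=
      pow_le_pow_of_le_one (by linarith) (by linarith)
        ((Finset.card_le_univ _).trans (by simp))
    have h1 : (1 - (p i : ℝ)) ^ Wᶜ.card ≤ 1 := pow_le_one₀ (by linarith) (by linarith)
    calc _ ≤ (1 - (1 - (p i : ℝ)) ^ n) ^ W.card := by
          refine pow_le_pow_left₀ (by linarith) (by linarith) _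
      _ ≤ Real.exp (-(1 - (p i : ℝ)) ^ n) ^ W.card := by
          refine pow_le_pow_left₀ (by linarith) ?_ _
          have := Real.add_one_le_exp (-(1 - (p i : ℝ)) ^ n)
          linarith
      _ = _ := by rw [← Real.exp_nat_mul]; congr 1; ring

end Jigsaw

/-! ### Lower bounds for the joining probability and analytic estimates -/

namespace Jigsaw

variable {r : ℕ}

theorem half_min_le_one_sub_pow (p : unitInterval) (k : ℕ) :
    min 1 (k * (p : ℝ)) / 2 ≤ 1 - (1 - (p : ℝ)) ^ k := by
  have hp0 := p.2.1
  have hp1 := p.2.2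
  have hx : 0 ≤ k * (p : ℝ) := by positivity
  have h1 : (1 - (p : ℝ)) ^ k ≤ Real.exp (-(k * p)) := by
    rw [← mul_neg, Real.exp_nat_mul]
    exact pow_le_pow_left₀ (by linarith) (Real.one_sub_le_exp_neg _) _
  have h2 : Real.exp (-(k * (p : ℝ))) ≤ 1 / (1 + k * p) := by
    rw [Real.exp_neg, ← one_div]
    exact one_div_le_one_div_of_le (by linarith) (by linarith [Real.add_one_le_exp (k * (p : ℝ))])
  have h3 : min 1 (k * (p : ℝ)) / 2 ≤ 1 - 1 / (1 + k * p) := by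
    rw [one_sub_div (by positivity), div_le_div_iff₀ two_pos (by positivity)]
    rcases le_total 1 (k * (p : ℝ)) with h | h
    · rw [min_eq_left h]; linarith
    · rw [min_eq_right h]; nlinarith
  linarith

/-- By monotonicity the colours with `k p_i < 1` form an initial segment; `m` is its length. -/
theorem exists_prod_min_eq {p : Fin r → unitInterval} (hp : Monotone p) (k : ℕ) :
    ∃ m ≤ r, ∏ i, min 1 (k * (p i : ℝ)) = (k : ℝ) ^ m * prefixProd p m := by
  classical
  have hex : ∃ m, m ≤ r ∧ ∀ i : Fin r, m ≤ i.val → 1 ≤ k * (p i : ℝ) :=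
    ⟨r, le_rfl, fun i hi => absurd i.2 (by omega)⟩
  obtain ⟨hmr, hm⟩ := Nat.find_spec hex
  refine ⟨Nat.find hex, hmr, ?_⟩
  have hlt : ∀ i : Fin r, i.val < Nat.find hex → k * (p i : ℝ) ≤ 1 := by
    intro i hi
    by_contra! hcon
    have := Nat.find_min hex hi
    refine this ⟨i.2.le, fun j hj => hcon.le.trans ?_⟩
    have : (p i : ℝ) ≤ p j := hp (Fin.le_def.2 hj)
    gcongr
  rw [prefixProd, ← Finset.prod_filter_mul_prod_filter_not Finset.univ
    (fun i : Fin r => i.val < Nat.find hex)]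
  rw [Finset.prod_congr rfl fun i hi => min_eq_right (hlt i (Finset.mem_filter.1 hi).2),
    Finset.prod_congr (s₁ := Finset.univ.filter fun i : Fin r => ¬ i.val < Nat.find hex) rfl
      fun i hi => min_eq_left (hm i (not_lt.1 (Finset.mem_filter.1 hi).2)),
    Finset.prod_const_one, mul_one, Finset.prod_mul_distrib, Finset.prod_const,
    Fin.card_filter_val_lt, min_eq_right hmr]

theorem exists_le_joinProb {p : Fin r → unitInterval} (hp : Monotone p) (k : ℕ) :
    ∃ m ≤ r, (1 / 2 : ℝ) ^ r * ((k : ℝ) ^ m * prefixProd p m) ≤ joinProb p k := by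
  obtain ⟨m, hm, h⟩ := exists_prod_min_eq hp k
  refine ⟨m, hm, ?_⟩
  rw [← h, joinProb]
  have : (1 / 2 : ℝ) ^ r = ∏ _i : Fin r, (1 / 2 : ℝ) := by simp
  rw [this, ← Finset.prod_mul_distrib]
  refine Finset.prod_le_prod (fun i _ => ?_) fun i _ => ?_
  · have := (p i).2.1
    positivity
  · have := half_min_le_one_sub_pow (p i) k
    linarith

/-- The lower bounds on the products `P_i` under which the process percolates. -/
structure Supercritical (C : ℝ) (n : ℕ) (p : Fin r → unitInterval) : Prop where
  mono : Monotone p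
  prefixProd_ge : ∀ i ∈ Finset.Icc 2 r, C / (n * Real.log n ^ (i - 1)) ≤ prefixProd p i
  prefixProd_one_ge : C * Real.log n / n ≤ prefixProd p 1

namespace Supercritical

variable {C : ℝ} {n : ℕ} {p : Fin r → unitInterval}

/-- The hypotheses give `k^m P_m ≥ (C k / n) (k / log n)^(m-1)` for `m ≥ 2`, and `(C k / n) log n`
for `m = 1`; `x` bounds the second factors from below. The worst case with `m ≥ 2` is `m = 2` for `k
≥ log n` and `m = r` for `k ≤ log n`. -/
theorem le_joinProb_aux (h : Supercritical C n p) (hC : 0 ≤ C) (hL : 1 ≤ Real.log n) (k : ℕ) {x : ℝ}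
    (hx1 : x ≤ Real.log n) (hx : ∀ m < r, 1 ≤ m → x ≤ (k / Real.log n) ^ m) :
    (1 / 2 : ℝ) ^ r * min 1 (C * k / n * x) ≤ joinProb p k := by
  obtain ⟨m, hm, hle⟩ := exists_le_joinProb h.mono k
  refine le_trans (mul_le_mul_of_nonneg_left ?_ (by positivity)) hle
  rcases Nat.lt_trichotomy m 1 with h0 | rfl | h2
  · obtain rfl : m = 0 := by omega
    simp [prefixProd]
  · refine (min_le_right _ _).trans ?_
    calc C * k / n * x ≤ C * k / n * Real.log n := by gcongr
      _ = (k : ℝ) ^ 1 * (C * Real.log n / n) := by ring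
      _ ≤ _ := by gcongr; exact h.prefixProd_one_ge
  · refine (min_le_right _ _).trans ?_
    obtain ⟨m, rfl⟩ : ∃ l, m = l + 1 := ⟨m - 1, by omega⟩
    have := h.prefixProd_ge (m + 1) (Finset.mem_Icc.2 ⟨by omega, hm⟩)
    rw [Nat.add_sub_cancel] at this
    calc C * k / n * x ≤ C * k / n * (k / Real.log n) ^ m := by
          gcongr; exact hx m (by omega) (by omega)
      _ = (k : ℝ) ^ (m + 1) * (C / (n * Real.log n ^ m)) := by
          rw [div_pow, pow_succ]; field_simp
      _ ≤ _ := by gcongr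

theorem le_joinProb_of_log_le (h : Supercritical C n p) (hC : 0 ≤ C) (hL : 1 ≤ Real.log n) {k : ℕ}
    (hk : Real.log n ≤ k) :
    (1 / 2 : ℝ) ^ r * min 1 (C * k / n * min (Real.log n) (k / Real.log n)) ≤ joinProb p k := by
  refine h.le_joinProb_aux hC hL k (min_le_left _ _) fun m _ hm => (min_le_right _ _).trans ?_
  refine le_self_pow₀ ?_ (by omega)
  rwa [one_le_div (by linarith)]

theorem le_joinProb_of_le_log (h : Supercritical C n p) (hC : 0 ≤ C) (hL : 1 ≤ Real.log n) {k : ℕ}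
    (hk : k ≤ Real.log n) :
    (1 / 2 : ℝ) ^ r * min 1 (C * k / n * (k / Real.log n) ^ (r - 1)) ≤ joinProb p k := by
  have h0 : 0 ≤ k / Real.log n := by positivity
  have h1 : k / Real.log n ≤ 1 := (div_le_one (by linarith)).2 hk
  refine h.le_joinProb_aux hC hL k ((pow_le_one₀ h0 h1).trans hL) fun m hm _ => ?_
  exact pow_le_pow_of_le_one h0 h1 (by omega)

/-- Union bound over the colour without a neighbour, with `p_i ≥ p_1` and `r ≤ e^r`. -/
theorem one_sub_joinProb_le (h : Supercritical C n p) (k : ℕ) :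
    1 - joinProb p k ≤ Real.exp (r - C * Real.log n / n * k) := by
  have h1 : ∀ i, C * Real.log n / n ≤ p i := by
    intro i
    have hr : 0 < r := i.pos
    refine h.prefixProd_one_ge.trans ?_
    have : (Finset.univ.filter fun j : Fin r => j.val < 1) = {⟨0, hr⟩} := by
      ext j
      simp [Fin.ext_iff]
    rw [prefixProd, this, Finset.prod_singleton]
    exact h.mono (Fin.le_def.2 (Nat.zero_le _))
  have h2 : ∀ s : Finset (Fin r), 1 - ∏ i ∈ s, (1 - (1 - (p i : ℝ)) ^ k) ≤
      ∑ i ∈ s, (1 - (p i : ℝ)) ^ k := by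
    intro s
    induction s using Finset.induction_on with
    | empty => simp
    | insert a s ha ih =>
      rw [Finset.prod_insert ha, Finset.sum_insert ha]
      have h0 : 0 ≤ (1 - (p a : ℝ)) ^ k := pow_nonneg (sub_nonneg.2 (p a).2.2) _
      have h3 : ∏ i ∈ s, (1 - (1 - (p i : ℝ)) ^ k) ≤ 1 :=
        Finset.prod_le_one (fun i _ => sub_nonneg.2
          (pow_le_one₀ (sub_nonneg.2 (p i).2.2) (sub_le_self _ (p i).2.1)))
          fun i _ => sub_le_self _ (pow_nonneg (sub_nonneg.2 (p i).2.2) _)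
      nlinarith
  have h3 : ∀ i, (1 - (p i : ℝ)) ^ k ≤ Real.exp (-(C * Real.log n / n * k)) := by
    intro i
    calc (1 - (p i : ℝ)) ^ k ≤ Real.exp (-(p i : ℝ)) ^ k :=
          pow_le_pow_left₀ (sub_nonneg.2 (p i).2.2) (Real.one_sub_le_exp_neg _) _
      _ = Real.exp (-(p i * k)) := by rw [← Real.exp_nat_mul]; congr 1; ring
      _ ≤ _ := by
          rw [Real.exp_le_exp]
          have := h1 i
          gcongr
  calc 1 - joinProb p k ≤ ∑ i, (1 - (p i : ℝ)) ^ k := h2 Finset.univ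
    _ ≤ ∑ _i : Fin r, Real.exp (-(C * Real.log n / n * k)) := Finset.sum_le_sum fun i _ => h3 i
    _ = r * Real.exp (-(C * Real.log n / n * k)) := by simp
    _ ≤ Real.exp r * Real.exp (-(C * Real.log n / n * k)) := by
        gcongr
        linarith [Real.add_one_le_exp (r : ℝ)]
    _ = _ := by rw [← Real.exp_add, sub_eq_add_neg]

end Supercritical

/-- For small `x` the cost `-log (1 - e^(-x))` is only logarithmic; bounding it by `s x^(-1/s)`,
with `s` free, keeps the sum over early layers geometric. -/
theorem exp_neg_div_le_one_sub_exp {s : ℕ} (hs : 1 ≤ s) {x y : ℝ} (hy : 0 < y) (hyx : y ^ s ≤ x) :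
    Real.exp (-(s / y)) ≤ 1 - Real.exp (-x) := by
  have hys : 0 < y ^ s := by positivity
  have h1 : Real.exp (-x) ≤ 1 / (1 + y ^ s) := by
    rw [Real.exp_neg, ← one_div]
    exact one_div_le_one_div_of_le (by linarith) (by linarith [Real.add_one_le_exp x])
  have h2 : Real.exp (-(1 / y)) ≤ y / (1 + y) := by
    rw [Real.exp_neg, inv_le_comm₀ (Real.exp_pos _) (by positivity), inv_div]
    have := Real.add_one_le_exp (1 / y)
    have e : (1 + y) / y = 1 / y + 1 := by field_simp
    linarith
  have h3 : 1 + y ^ s ≤ (1 + y) ^ s := by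
    have := pow_add_pow_le (x := (1 : ℝ)) (y := y) zero_le_one hy.le (n := s) (by omega)
    simpa using this
  calc Real.exp (-(s / y)) = Real.exp (-(1 / y)) ^ s := by
        rw [← Real.exp_nat_mul]; congr 1; ring
    _ ≤ (y / (1 + y)) ^ s := by gcongr
    _ = y ^ s / (1 + y) ^ s := div_pow _ _ _
    _ ≤ y ^ s / (1 + y ^ s) := by gcongr
    _ = 1 - 1 / (1 + y ^ s) := by field_simp; ring
    _ ≤ _ := by linarith

/-- Quadratic decay is needed for late layers: there `y` grows like the layer size, so a cost `1 /
y` per vertex would not be summable. -/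
theorem exp_neg_two_div_sq_le_one_sub_exp {x y : ℝ} (hy : 0 < y) (hyx : y ≤ x) :
    Real.exp (-(2 / y ^ 2)) ≤ 1 - Real.exp (-x) := by
  have h1 : Real.exp (-x) ≤ 1 / (1 + y ^ 2 / 2) := by
    refine (Real.exp_le_exp.2 (neg_le_neg hyx)).trans ?_
    rw [Real.exp_neg, ← one_div]
    exact one_div_le_one_div_of_le (by positivity)
      (by linarith [Real.quadratic_le_exp_of_nonneg hy.le])
  have h2 : Real.exp (-(2 / y ^ 2)) ≤ 1 / (1 + 2 / y ^ 2) := by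
    rw [Real.exp_neg, ← one_div]
    exact one_div_le_one_div_of_le (by positivity)
      (by linarith [Real.add_one_le_exp (2 / y ^ 2)])
  have h3 : 1 / (1 + 2 / y ^ 2) = 1 - 1 / (1 + y ^ 2 / 2) := by field_simp; ring
  linarith

theorem eventually_mul_log_pow_le (K : ℝ) (m : ℕ) :
    ∀ᶠ n : ℕ in atTop, K * Real.log n ^ m ≤ n := by
  have h := (Real.isLittleO_pow_log_id_atTop (n := m)).const_mul_left K
  have h3 := (tendsto_natCast_atTop_atTop (R := ℝ)).eventually (h.bound one_pos)
  filter_upwards [h3] with n hn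
  simp only [id, one_mul, Real.norm_natCast] at hn
  exact (le_abs_self _).trans hn

theorem eventually_one_le_log : ∀ᶠ n : ℕ in atTop, 1 ≤ Real.log n :=
  (Real.tendsto_log_atTop.comp tendsto_natCast_atTop_atTop).eventually_ge_atTop 1

end Jigsaw

/-! ### No closed proper set of size at least `(log n)^2` -/

namespace Jigsaw

variable {r : ℕ}

/-- Three ranges, with `q` the joining probability. For `s` up to order `n / log n`, `q ≥ 6 s log n
/ n` beats `n^s`. From there to `n / 2`, `1 - q ≤ e^(-4)` beats `2^n`. Beyond `n / 2`, `1 - q ≤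
n^(-3)` beats the `n^(n-s)` choices of the complement. -/
theorem Supercritical.choose_mul_pow_le {C : ℝ} {n s : ℕ} {p : Fin r → unitInterval}
    (h : Supercritical C n p) (hC : 6 * 2 ^ r * (r + 4) ≤ C) (hL : 1 ≤ Real.log n)
    (hn : 2 * Real.log n ≤ n) (hs : Real.log n ^ 2 ≤ s) (hsn : s < n) :
    (n.choose s : ℝ) * (1 - joinProb p s) ^ (n - s) ≤ Real.exp (-(2 * Real.log n)) := by
  set L := Real.log n with hLdef
  have hn0 : (0 : ℝ) < n := by linarith
  have hC6 : 6 * 2 ^ r ≤ C := by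
    refine le_trans ?_ hC
    have : (0 : ℝ) < 6 * 2 ^ r := by positivity
    nlinarith [Nat.cast_nonneg (α := ℝ) r]
  have hCr : 6 * (r + 4) ≤ C := by
    refine le_trans ?_ hC
    have : (1 : ℝ) ≤ 2 ^ r := one_le_pow₀ (by norm_num)
    nlinarith [Nat.cast_nonneg (α := ℝ) r]
  have hC0 : 0 ≤ C := le_trans (by positivity) hC6
  have hq0 : 0 ≤ 1 - joinProb p s := sub_nonneg.2 (joinProb_le_one p s)
  have hsR : (s : ℝ) < n := by exact_mod_cast hsn
  have hns : ((n - s : ℕ) : ℝ) = n - s := Nat.cast_sub hsn.le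
  have hns1 : (1 : ℝ) ≤ n - s := by
    rw [← hns]
    have : 1 ≤ n - s := by omega
    exact_mod_cast this
  have hnexp : Real.exp L = n := Real.exp_log hn0
  have hs1 : 1 ≤ (s : ℝ) := le_trans (one_le_pow₀ hL) hs
  by_cases h1 : 6 * 2 ^ r * (s * L) ≤ n
  · have hsL : L ≤ s := le_trans (by nlinarith) hs
    have hq := h.le_joinProb_of_log_le hC0 hL hsL
    rw [min_eq_left ((le_div_iff₀ (by linarith)).2 (by rw [← sq]; exact hs))] at hq
    have hq2 : 6 * (s * L) / n ≤ joinProb p s := by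
      refine le_trans ?_ hq
      rw [one_div, inv_pow, inv_mul_eq_div, le_div_iff₀ (by positivity)]
      refine le_min ?_ ?_
      · rw [div_mul_eq_mul_div, div_le_one hn0]
        linarith
      · calc 6 * (s * L) / n * 2 ^ r = 6 * 2 ^ r * (s / n * L) := by ring
          _ ≤ C * (s / n * L) := by gcongr
          _ = _ := by ring
    have hs2 : 2 * (s : ℝ) ≤ n := by
      refine le_trans ?_ h1
      have h2 : (1 : ℝ) ≤ 2 ^ r := one_le_pow₀ (by norm_num)
      have h3 : (s : ℝ) ≤ s * L := by nlinarith
      nlinarith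
    calc (n.choose s : ℝ) * (1 - joinProb p s) ^ (n - s)
        ≤ Real.exp (L * s) * Real.exp (-(3 * (s * L))) := by
          refine mul_le_mul ?_ ?_ (pow_nonneg hq0 _) (Real.exp_pos _).le
          · rw [mul_comm, Real.exp_nat_mul, hnexp]
            exact_mod_cast Nat.choose_le_pow n s
          · calc (1 - joinProb p s) ^ (n - s) ≤ Real.exp (-joinProb p s) ^ (n - s) :=
                  pow_le_pow_left₀ hq0 (Real.one_sub_le_exp_neg _) _
              _ = Real.exp (-(joinProb p s * (n - s))) := by
                  rw [← Real.exp_nat_mul, hns]; congr 1; ring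
              _ ≤ _ := by
                  rw [Real.exp_le_exp, neg_le_neg_iff]
                  calc 3 * (s * L) = 6 * (s * L) / n * (n / 2) := by field_simp; norm_num
                    _ ≤ joinProb p s * (n - s) := by
                      have := joinProb_nonneg p s
                      gcongr
                      linarith
      _ = Real.exp (-(2 * L) * s) := by rw [← Real.exp_add]; congr 1; ring
      _ ≤ Real.exp (-(2 * L)) := by
          rw [Real.exp_le_exp]
          nlinarith
  · have hq := h.one_sub_joinProb_le s
    rw [← hLdef] at hq
    push Not at h1
    by_cases h2 : 2 * (s : ℝ) ≤ n
    · have hq2 : 1 - joinProb p s ≤ Real.exp (-4) := by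
        refine hq.trans ?_
        rw [Real.exp_le_exp]
        have : (r : ℝ) + 4 ≤ C * L / n * s := by
          calc (r : ℝ) + 4 = (r + 4) / n * n := by field_simp
            _ ≤ (r + 4) / n * (6 * 2 ^ r * (s * L)) := by gcongr
            _ = 6 * 2 ^ r * (r + 4) * (L / n * s) := by ring
            _ ≤ C * (L / n * s) := by gcongr
            _ = _ := by ring
        linarith
      calc (n.choose s : ℝ) * (1 - joinProb p s) ^ (n - s)
          ≤ Real.exp n * Real.exp (-(2 * n)) := by
            refine mul_le_mul ?_ ?_ (pow_nonneg hq0 _) (Real.exp_pos _).le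
            · calc (n.choose s : ℝ) ≤ 2 ^ n := by exact_mod_cast Nat.choose_le_two_pow n s
                _ ≤ Real.exp 1 ^ n := by
                  gcongr
                  linarith [Real.add_one_le_exp 1]
                _ = _ := by rw [← Real.exp_nat_mul, mul_one]
            · refine (pow_le_pow_left₀ hq0 hq2 _).trans ?_
              rw [← Real.exp_nat_mul, Real.exp_le_exp, hns]
              linarith
        _ = Real.exp (-n) := by rw [← Real.exp_add]; congr 1; ring
        _ ≤ _ := by rw [Real.exp_le_exp]; linarith
    · push Not at h2
      have hq2 : 1 - joinProb p s ≤ Real.exp (-(3 * L)) := by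
        refine hq.trans ?_
        rw [Real.exp_le_exp]
        have h3 : C * L / 2 ≤ C * L / n * s := by
          calc C * L / 2 = C * L / n * (n / 2) := by field_simp
            _ ≤ _ := by gcongr; linarith
        nlinarith [Nat.cast_nonneg (α := ℝ) r]
      calc (n.choose s : ℝ) * (1 - joinProb p s) ^ (n - s)
          ≤ Real.exp (L * (n - s)) * Real.exp (-(3 * L * (n - s))) := by
            refine mul_le_mul ?_ ?_ (pow_nonneg hq0 _) (Real.exp_pos _).le
            · rw [mul_comm, ← hns, Real.exp_nat_mul, hnexp, ← Nat.choose_symm hsn.le]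
              exact_mod_cast Nat.choose_le_pow n (n - s)
            · refine (pow_le_pow_left₀ hq0 hq2 _).trans ?_
              rw [← Real.exp_nat_mul, Real.exp_le_exp, hns]
              linarith
        _ = Real.exp (-(2 * L) * (n - s)) := by rw [← Real.exp_add]; congr 1; ring
        _ ≤ _ := by
            rw [Real.exp_le_exp]
            nlinarith

/-- With high probability, every proper set of at least `(log n) ^ 2` vertices has a vertex joined
to it from outside. -/
theorem Supercritical.prob_exists_closed_le {C : ℝ} {n : ℕ} {p : Fin r → unitInterval}
    (h : Supercritical C n p) (hC : 6 * 2 ^ r * (r + 4) ≤ C) (hL : 1 ≤ Real.log n)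
    (hn : 2 * Real.log n ≤ n) :
    prob p {G : RFoldGraph (Fin n) r | ∃ S : Finset (Fin n), Real.log n ^ 2 ≤ S.card ∧
      S ≠ Finset.univ ∧ ∀ x ∉ S, ¬ Joined G S x} ≤ 1 / n := by
  classical
  have hn0 : (0 : ℝ) < n := by linarith
  have hsub : {G : RFoldGraph (Fin n) r | ∃ S : Finset (Fin n), Real.log n ^ 2 ≤ S.card ∧
      S ≠ Finset.univ ∧ ∀ x ∉ S, ¬ Joined G S x} ⊆
      ⋃ s ∈ (Finset.range n).filter fun s : ℕ => Real.log n ^ 2 ≤ s,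
        ⋃ S ∈ (Finset.univ : Finset (Fin n)).powersetCard s, {G | ∀ x ∈ Sᶜ, ¬ Joined G S x} := by
    rintro G ⟨S, h1, h2, h3⟩
    refine Set.mem_biUnion (x := S.card) ?_ (Set.mem_biUnion (x := S) (by simp) ?_)
    · simp only [Finset.coe_filter, Finset.mem_range, Set.mem_ofPred_eq]
      refine ⟨?_, h1⟩
      have := Finset.card_lt_univ_of_notMem (s := S) (x := (Finset.sdiff_nonempty.2
        (fun hsub => h2 (Finset.univ_subset_iff.1 hsub)) : (Finset.univ \ S).Nonempty).choose)
        (Finset.mem_sdiff.1 (Exists.choose_spec _)).2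
      simpa using this
    · simpa using h3
  refine (prob_mono p hsub).trans ((prob_biUnion_le p _ _).trans ?_)
  refine (Finset.sum_le_card_nsmul _ _ (Real.exp (-(2 * Real.log n))) fun s hs => ?_).trans ?_
  · obtain ⟨h1, h2⟩ := Finset.mem_filter.1 hs
    refine (prob_biUnion_le p _ _).trans
      (le_trans (le_of_eq ?_) (h.choose_mul_pow_le hC hL hn h2 (Finset.mem_range.1 h1)))
    rw [Finset.sum_congr rfl fun S hS => by
      rw [prob_forall_not_joined p disjoint_compl_right, Finset.card_compl, Fintype.card_fin,
        (Finset.mem_powersetCard.1 hS).2], Finset.sum_const, Finset.card_powersetCard,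
      nsmul_eq_mul, Finset.card_univ, Fintype.card_fin]
  · rw [nsmul_eq_mul]
    have h1 : (((Finset.range n).filter fun s : ℕ => Real.log n ^ 2 ≤ s).card : ℝ) ≤ n := by
      exact_mod_cast (Finset.card_filter_le _ _).trans (by simp)
    have h2 : Real.exp (-(2 * Real.log n)) = 1 / n ^ 2 := by
      rw [Real.exp_neg, two_mul, Real.exp_add, Real.exp_log hn0, one_div, sq]
    rw [h2]
    calc _ ≤ (n : ℝ) * (1 / n ^ 2) := by gcongr
      _ = _ := by field_simp

end Jigsaw

/-! ### Success probability of a chain of layers -/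

namespace Jigsaw

variable {r : ℕ}

theorem sum_two_pow_mul_three_halves_pow_le (m : ℕ) :
    ∑ t ∈ Finset.range m, (2 : ℝ) ^ t * (3 / 2) ^ (m - t) ≤ 3 * 2 ^ m := by
  have key : ∑ t ∈ Finset.range m, (2 : ℝ) ^ t * (3 / 2) ^ (m - t) =
      3 * 2 ^ m - 3 * (3 / 2) ^ m := by
    induction m with
    | zero => simp
    | succ m ih =>
      have h1 : ∀ t ∈ Finset.range m, (2 : ℝ) ^ t * (3 / 2) ^ (m + 1 - t) =
          3 / 2 * (2 ^ t * (3 / 2) ^ (m - t)) := by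
        intro t ht
        rw [Nat.succ_sub (Finset.mem_range.1 ht).le, pow_succ]
        ring
      rw [Finset.sum_range_succ, Finset.sum_congr rfl h1, ← Finset.mul_sum, ih,
        Nat.add_sub_cancel_left]
      ring
  rw [key]
  have : (0 : ℝ) ≤ 3 * (3 / 2) ^ m := by positivity
  linarith

/-- The number of blocks of size `k` available in a pool of `n` vertices is of order `n / k`. -/
theorem div_le_natCast_div {n k : ℕ} (hk : 0 < k) (hn : 8 * k ≤ n) :
    (n : ℝ) / (8 * k) ≤ (n / (4 * k) : ℕ) := by
  have h1 := Nat.lt_div_mul_add (a := n) (b := 4 * k) (by omega)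
  have h2 : n ≤ n / (4 * k) * (8 * k) := by
    have : 1 ≤ n / (4 * k) := (Nat.one_le_div_iff (by omega)).2 (by omega)
    nlinarith
  rw [div_le_iff₀ (by positivity)]
  exact_mod_cast h2

theorem one_sub_exp_le_one_sub_pow {q x : ℝ} {b : ℕ} (hq : q ≤ 1) (hx : x ≤ q * b) :
    1 - Real.exp (-x) ≤ 1 - (1 - q) ^ b := by
  have h1 : (1 - q) ^ b ≤ Real.exp (-q) ^ b :=
    pow_le_pow_left₀ (by linarith) (Real.one_sub_le_exp_neg _) _
  have h2 : Real.exp (-q) ^ b ≤ Real.exp (-x) := by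
    rw [← Real.exp_nat_mul, Real.exp_le_exp]
    linarith
  linarith

namespace Supercritical

variable {C : ℝ} {n : ℕ} {p : Fin r → unitInterval}

/-- The lower bound for the probability that a layer of size `2 ^ t` has a next layer. -/
noncomputable def layerProb (p : Fin r → unitInterval) (n t : ℕ) : ℝ :=
  (1 - (1 - joinProb p (2 ^ t)) ^ (n / (4 * 2 ^ t))) ^ 2 ^ (t + 1)

theorem layerProb_mem (p : Fin r → unitInterval) (n t : ℕ) :
    0 ≤ layerProb p n t ∧ layerProb p n t ≤ 1 := by
  have h0 := joinProb_nonneg p (2 ^ t)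
  have h1 := joinProb_le_one p (2 ^ t)
  have h2 : (1 - joinProb p (2 ^ t)) ^ (n / (4 * 2 ^ t)) ≤ 1 :=
    pow_le_one₀ (by linarith) (by linarith)
  have h3 : 0 ≤ (1 - joinProb p (2 ^ t)) ^ (n / (4 * 2 ^ t)) := pow_nonneg (by linarith) _
  exact ⟨pow_nonneg (by linarith) _, pow_le_one₀ (by linarith) (by linarith)⟩

/-- Bounds from below the expected number of joined vertices in a block. The constant `2^(r+3)`
absorbs the `2^(-r)` of the joining probability and the `8` of the block size. -/
theorem min_le_joinProb_mul {D x : ℝ} {k : ℕ} (hk : 0 < k) (hn : 8 * k ≤ n)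
    (hq : (1 / 2 : ℝ) ^ r * min 1 (2 ^ (r + 3) * D * k / n * x) ≤ joinProb p k) :
    min ((n : ℝ) / (2 ^ (r + 3) * k)) (D * x) ≤ joinProb p k * (n / (4 * k) : ℕ) := by
  have hn0 : (0 : ℝ) < n := by
    have : 0 < n := by omega
    exact_mod_cast this
  have hk0 : (0 : ℝ) < k := by exact_mod_cast hk
  calc min ((n : ℝ) / (2 ^ (r + 3) * k)) (D * x)
      = (1 / 2 : ℝ) ^ r * min 1 (2 ^ (r + 3) * D * k / n * x) * (n / (8 * k)) := by
        have h0 : (0 : ℝ) ≤ (1 / 2) ^ r * (n / (8 * k)) := by positivity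
        rw [mul_right_comm, mul_min_of_nonneg _ _ h0, mul_one]
        congr 1
        · rw [one_div, inv_pow, pow_add]
          field_simp
          norm_num
        · rw [one_div, inv_pow, pow_add]
          field_simp
          norm_num
    _ ≤ joinProb p k * (n / (8 * k)) := by gcongr
    _ ≤ _ := mul_le_mul_of_nonneg_left (div_le_natCast_div hk hn) (joinProb_nonneg p k)

/-- Layers smaller than `log n`. A block expects at least `y^(2(r-1))` joined vertices with `y = E
(2/3)^(a-t)`, because `(2/3)^2 ≤ 1/2`. The resulting cost per block grows like `(3/2)^(a-t)`, slower
than the layer sizes shrink. -/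
theorem le_layerProb_of_lt (hr : 2 ≤ r) {D : ℝ} (h : Supercritical (2 ^ (r + 3) * D) n p)
    (hD : (48 * (2 * (r - 1) : ℕ) : ℝ) ^ (2 * (r - 1)) ≤ D) (hL : 1 ≤ Real.log n) {a t : ℕ}
    (ha1 : (2 : ℝ) ^ a ≤ 2 * Real.log n) (ha2 : Real.log n ≤ 2 ^ a)
    (hn : 2 ^ (r + 3) * D * Real.log n ≤ n) (hn8 : 8 * Real.log n ≤ n) (hta : t < a) :
    Real.exp (-(1 / 24 * (2 ^ t * (3 / 2) ^ (a - t)))) ≤ layerProb p n t := by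
  set L := Real.log n
  obtain ⟨r, rfl⟩ : ∃ l, r = l + 1 := ⟨r - 1, by omega⟩
  simp only [Nat.add_sub_cancel] at hD
  set E : ℝ := 48 * (2 * r : ℕ) with hE
  have hr0 : (0 : ℝ) < (2 * r : ℕ) := by
    have : 0 < 2 * r := by omega
    exact_mod_cast this
  have hE0 : 0 < E := by positivity
  have hD0 : 0 ≤ D := le_trans (by positivity) hD
  have hkL : (2 : ℝ) ^ t ≤ L := by
    have : (2 : ℝ) ^ (t + 1) ≤ 2 ^ a := pow_le_pow_right₀ (by norm_num) (by omega)
    rw [pow_succ] at this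
    linarith
  have hkL' : ((2 ^ t : ℕ) : ℝ) ≤ L := by exact_mod_cast hkL
  have hk8 : 8 * 2 ^ t ≤ n := by
    have : (8 : ℝ) * 2 ^ t ≤ n := by linarith
    exact_mod_cast this
  have hq := min_le_joinProb_mul (by positivity) hk8
    (h.le_joinProb_of_le_log (by positivity) hL hkL')
  have hratio : (1 / 2 : ℝ) ^ (a - t) ≤ ((2 ^ t : ℕ) : ℝ) / L := by
    rw [le_div_iff₀ (by linarith)]
    calc (1 / 2 : ℝ) ^ (a - t) * L ≤ (1 / 2 : ℝ) ^ (a - t) * 2 ^ a := by gcongr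
      _ = (1 / 2 : ℝ) ^ (a - t) * (2 ^ (a - t) * 2 ^ t) := by
          rw [← pow_add, Nat.sub_add_cancel hta.le]
      _ = ((2 ^ t : ℕ) : ℝ) := by
          rw [← mul_assoc, ← mul_pow]
          simp
  have hy : (E * (2 / 3) ^ (a - t)) ^ (2 * r) ≤
      joinProb p (2 ^ t) * (n / (4 * 2 ^ t) : ℕ) := by
    refine le_trans (le_min ?_ ?_) hq
    · calc (E * (2 / 3) ^ (a - t)) ^ (2 * r) ≤ E ^ (2 * r) := by
            gcongr
            exact mul_le_of_le_one_right hE0.le (pow_le_one₀ (by norm_num) (by norm_num))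
        _ ≤ D := hD
        _ ≤ _ := by
            rw [le_div_iff₀ (by positivity)]
            calc D * (2 ^ (r + 1 + 3) * ((2 ^ t : ℕ) : ℝ)) ≤ D * (2 ^ (r + 1 + 3) * L) := by gcongr
              _ = 2 ^ (r + 1 + 3) * D * L := by ring
              _ ≤ n := hn
    · calc (E * (2 / 3) ^ (a - t)) ^ (2 * r) = E ^ (2 * r) * (((2 / 3) ^ 2) ^ (a - t)) ^ r := by
            rw [mul_pow, ← pow_mul, ← pow_mul, ← pow_mul]
            congr 2
            ring
        _ ≤ D * ((1 / 2 : ℝ) ^ (a - t)) ^ r := by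
            gcongr
            norm_num
        _ ≤ _ := by
            rw [Nat.add_sub_cancel]
            gcongr
  have h1 := (exp_neg_div_le_one_sub_exp (s := 2 * r) (by omega) (by positivity) hy).trans
    (one_sub_exp_le_one_sub_pow (joinProb_le_one p _) le_rfl)
  rw [layerProb]
  refine le_trans (le_of_eq ?_) (pow_le_pow_left₀ (Real.exp_pos _).le h1 _)
  rw [← Real.exp_nat_mul]
  congr 1
  have h3 : ((2 : ℝ) / 3) ^ (a - t) * (3 / 2) ^ (a - t) = 1 := by
    rw [← mul_pow]; norm_num
  have h4 : ((2 * r : ℕ) : ℝ) / (E * (2 / 3) ^ (a - t)) = 1 / 48 * (3 / 2) ^ (a - t) := by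
    rw [div_eq_iff (by positivity), hE]
    linear_combination (-((2 * r : ℕ) : ℝ)) * h3
  rw [h4]
  push_cast
  ring

/-- Layers from about `log n` to `(log n)^2`. A block expects at least `(D / 4) 2^i` joined
vertices, so the cost per block is `O(4^(-i))` against a number of blocks proportional to `2^(a+i)`.
-/
theorem le_layerProb_add {D : ℝ} (h : Supercritical (2 ^ (r + 3) * D) n p)
    (hD : 32 ≤ D) (hL : 1 ≤ Real.log n) {a i : ℕ}
    (ha1 : (2 : ℝ) ^ a ≤ 2 * Real.log n) (ha2 : Real.log n ≤ 2 ^ a)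
    (hn : 2 * (2 ^ (r + 3) * D) * Real.log n ^ 3 ≤ n) (hn8 : 32 * Real.log n ^ 2 ≤ n)
    (hia : i < a) :
    Real.exp (-(2 ^ a / 16 * (1 / 2) ^ i)) ≤ layerProb p n (a + i) := by
  set L := Real.log n
  have hi : (2 : ℝ) ^ i ≤ 2 ^ a := pow_le_pow_right₀ (by norm_num) hia.le
  have hkdef : ((2 ^ (a + i) : ℕ) : ℝ) = 2 ^ a * 2 ^ i := by push_cast; rw [pow_add]
  have hi1 : (1 : ℝ) ≤ 2 ^ i := one_le_pow₀ (by norm_num)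
  have hk1 : L * 2 ^ i ≤ ((2 ^ (a + i) : ℕ) : ℝ) := by rw [hkdef]; gcongr
  have hk2 : ((2 ^ (a + i) : ℕ) : ℝ) ≤ 4 * L ^ 2 := by
    rw [hkdef]
    calc (2 : ℝ) ^ a * 2 ^ i ≤ (2 * L) * (2 * L) := by
          gcongr
          exact hi.trans ha1
      _ = _ := by ring
  have hkL : L ≤ ((2 ^ (a + i) : ℕ) : ℝ) := le_trans (by nlinarith) hk1
  have hk8 : 8 * 2 ^ (a + i) ≤ n := by
    have : (8 : ℝ) * ((2 ^ (a + i) : ℕ) : ℝ) ≤ n := by linarith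
    exact_mod_cast this
  have hq := min_le_joinProb_mul (by positivity) hk8
    (h.le_joinProb_of_log_le (by positivity) hL hkL)
  have hy : D / 4 * 2 ^ i ≤
      joinProb p (2 ^ (a + i)) * (n / (4 * 2 ^ (a + i)) : ℕ) := by
    refine le_trans (le_min ?_ ?_) hq
    · rw [le_div_iff₀ (by positivity)]
      calc D / 4 * 2 ^ i * (2 ^ (r + 3) * ((2 ^ (a + i) : ℕ) : ℝ))
          ≤ D / 4 * (2 * L) * (2 ^ (r + 3) * (4 * L ^ 2)) := by
            gcongr
            exact hi.trans ha1
        _ = 2 * (2 ^ (r + 3) * D) * L ^ 3 := by ring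
        _ ≤ n := hn
    · rw [div_mul_eq_mul_div, mul_div_assoc]
      gcongr
      refine le_min ?_ ?_
      · have := hi.trans ha1
        linarith
      · rw [le_div_iff₀ (by linarith)]
        have : 0 < L * 2 ^ i := by positivity
        linarith
  have h1 := (exp_neg_two_div_sq_le_one_sub_exp (by positivity) hy).trans
    (one_sub_exp_le_one_sub_pow (joinProb_le_one p _) le_rfl)
  rw [layerProb]
  refine le_trans ?_ (pow_le_pow_left₀ (Real.exp_pos _).le h1 _)
  rw [← Real.exp_nat_mul, Real.exp_le_exp, mul_neg, neg_le_neg_iff]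
  have h4 : 2 / (D / 4 * 2 ^ i) ^ 2 ≤ 1 / 32 * ((1 / 2) ^ i * (1 / 2) ^ i) := by
    have h5 : ((1 : ℝ) / 2) ^ i = 1 / 2 ^ i := by rw [div_pow, one_pow]
    rw [h5]
    calc 2 / (D / 4 * 2 ^ i) ^ 2 ≤ 2 / (32 / 4 * 2 ^ i) ^ 2 := by gcongr
      _ = _ := by field_simp; norm_num
  calc ((2 ^ (a + i + 1) : ℕ) : ℝ) * (2 / (D / 4 * 2 ^ i) ^ 2)
      ≤ ((2 ^ (a + i + 1) : ℕ) : ℝ) * (1 / 32 * ((1 / 2) ^ i * (1 / 2) ^ i)) := by gcongr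
    _ = 2 ^ a / 16 * (1 / 2) ^ i * (2 ^ i * (1 / 2) ^ i) := by
        push_cast; rw [pow_succ, pow_add]; ring
    _ = _ := by rw [← mul_pow]; norm_num

/-- Both halves of the chain cost a geometric sum dominated by the layers of size near `2^a ≤ 2 log
n`, at most `log n / 4` each. -/
theorem le_prod_layerProb (hr : 2 ≤ r) {D : ℝ} (h : Supercritical (2 ^ (r + 3) * D) n p)
    (hD : (48 * (2 * (r - 1) : ℕ) : ℝ) ^ (2 * (r - 1)) ≤ D) (hD32 : 32 ≤ D)
    (hL : 1 ≤ Real.log n) {a : ℕ}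
    (ha1 : (2 : ℝ) ^ a ≤ 2 * Real.log n) (ha2 : Real.log n ≤ 2 ^ a)
    (hn : 2 * (2 ^ (r + 3) * D) * Real.log n ^ 3 ≤ n) (hn8 : 32 * Real.log n ^ 2 ≤ n) :
    Real.exp (-(Real.log n / 2)) ≤ ∏ t ∈ Finset.range (2 * a), layerProb p n t := by
  set L := Real.log n with hLdef
  have hL3 : L ≤ L ^ 3 := le_self_pow₀ hL (by norm_num)
  have hL2 : L ≤ L ^ 2 := le_self_pow₀ hL (by norm_num)
  have hC0 : 0 ≤ 2 ^ (r + 3) * D := by positivity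
  have hn1 : 2 ^ (r + 3) * D * L ≤ n := by
    have h1 : 2 ^ (r + 3) * D * L ≤ 2 ^ (r + 3) * D * L ^ 3 := by gcongr
    have h2 : 0 ≤ 2 ^ (r + 3) * D * L ^ 3 := by positivity
    linarith
  rw [two_mul, Finset.prod_range_add]
  have h1 : Real.exp (-(L / 4)) ≤ ∏ t ∈ Finset.range a, layerProb p n t := by
    calc Real.exp (-(L / 4))
        ≤ Real.exp (∑ t ∈ Finset.range a, -(1 / 24 * (2 ^ t * (3 / 2) ^ (a - t)))) := by
          rw [Real.exp_le_exp, Finset.sum_neg_distrib, neg_le_neg_iff, ← Finset.mul_sum]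
          have := sum_two_pow_mul_three_halves_pow_le a
          linarith
      _ = ∏ t ∈ Finset.range a, Real.exp (-(1 / 24 * (2 ^ t * (3 / 2) ^ (a - t)))) :=
          Real.exp_sum _ _
      _ ≤ _ := Finset.prod_le_prod (fun _ _ => (Real.exp_pos _).le) fun t ht =>
          h.le_layerProb_of_lt hr hD hL ha1 ha2 hn1 (by linarith) (Finset.mem_range.1 ht)
  have h2 : Real.exp (-(L / 4)) ≤ ∏ i ∈ Finset.range a, layerProb p n (a + i) := by
    calc Real.exp (-(L / 4))
        ≤ Real.exp (∑ i ∈ Finset.range a, -(2 ^ a / 16 * (1 / 2) ^ i)) := by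
          rw [Real.exp_le_exp, Finset.sum_neg_distrib, neg_le_neg_iff, ← Finset.mul_sum]
          have h3 := sum_geometric_two_le a
          calc 2 ^ a / 16 * ∑ i ∈ Finset.range a, (1 / 2 : ℝ) ^ i ≤ (2 * L) / 16 * 2 := by gcongr
            _ = _ := by ring
      _ = ∏ i ∈ Finset.range a, Real.exp (-(2 ^ a / 16 * (1 / 2) ^ i)) := Real.exp_sum _ _
      _ ≤ _ := Finset.prod_le_prod (fun _ _ => (Real.exp_pos _).le) fun i hi =>
          h.le_layerProb_add hD32 hL ha1 ha2 hn hn8 (Finset.mem_range.1 hi)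
  calc Real.exp (-(L / 2)) = Real.exp (-(L / 4)) * Real.exp (-(L / 4)) := by
        rw [← Real.exp_add]; congr 1; ring
    _ ≤ _ := mul_le_mul h1 h2 (Real.exp_pos _).le ((Real.exp_pos _).le.trans h1)

/-- With high probability some vertex starts a chain of doubling layers whose last layer has more
than `(log n) ^ 2` vertices. -/
theorem prob_noSeed_univ_le (hr : 2 ≤ r) {D : ℝ} (h : Supercritical (2 ^ (r + 3) * D) n p)
    (hD : (48 * (2 * (r - 1) : ℕ) : ℝ) ^ (2 * (r - 1)) ≤ D) (hD32 : 32 ≤ D)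
    (hL : 1 ≤ Real.log n) {a : ℕ}
    (ha1 : (2 : ℝ) ^ a ≤ 2 * Real.log n) (ha2 : Real.log n ≤ 2 ^ a)
    (hn : 2 * (2 ^ (r + 3) * D) * Real.log n ^ 3 ≤ n) (hn8 : 32 * Real.log n ^ 2 ≤ n) :
    prob p (noSeed r (2 * a) (Finset.univ : Finset (Fin n))) ≤
      Real.exp (-(Real.exp (Real.log n / 2) / (32 * Real.log n ^ 2))) := by
  classical
  have hρ := h.le_prod_layerProb hr hD hD32 hL ha1 ha2 hn hn8
  set L := Real.log n with hLdef
  have hn0 : (0 : ℝ) < n := lt_of_lt_of_le (by positivity) hn8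
  set K := 2 ^ (2 * a) with hK
  have hK0 : 0 < K := by positivity
  have hKL : (K : ℝ) ≤ 4 * L ^ 2 := by
    rw [hK, Nat.cast_pow, mul_comm 2 a, pow_mul]
    calc (((2 : ℕ) : ℝ) ^ a) ^ 2 ≤ (2 * L) ^ 2 := by gcongr; exact_mod_cast ha1
      _ = _ := by ring
  have hK8 : 8 * K ≤ n := by
    have : (8 : ℝ) * K ≤ n := by linarith
    exact_mod_cast this
  -- Half of the vertices always remain as a fresh pool; the trials together use at most a quarter.
  have hj : n / 2 + n / (4 * K) * 2 ^ (2 * a) ≤ (Finset.univ : Finset (Fin n)).card := by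
    rw [Finset.card_univ, Fintype.card_fin, ← hK]
    have := Nat.div_mul_le_self n (4 * K)
    have e : n / (4 * K) * (4 * K) = 4 * (n / (4 * K) * K) := by ring
    omega
  have hmain := prob_noSeed_le (V := Fin n) p (2 * a) (n / 2) (layerProb p n)
    (fun t => (layerProb_mem p n t).1) (fun t => (layerProb_mem p n t).2)
    (fun t _ N W hNW hNc hW => by
      have := le_prob_card_joined p hNW (m := 2 ^ (t + 1)) (b := n / (4 * 2 ^ t)) (by
        have := Nat.div_mul_le_self n (4 * 2 ^ t)
        have e : n / (4 * 2 ^ t) * (4 * 2 ^ t) = 2 * (2 ^ (t + 1) * (n / (4 * 2 ^ t))) := by ring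
        omega)
      rw [hNc] at this
      exact this) (n / (4 * K)) Finset.univ hj
  set ρ := ∏ t ∈ Finset.range (2 * a), layerProb p n t with hρdef
  have hρ1 : ρ ≤ 1 :=
    Finset.prod_le_one (fun t _ => (layerProb_mem p n t).1) fun t _ => (layerProb_mem p n t).2
  have hρ0 : 0 ≤ ρ := (Real.exp_pos _).le.trans hρ
  have hb := div_le_natCast_div hK0 hK8
  refine hmain.trans ?_
  calc (1 - ρ) ^ (n / (4 * K)) ≤ Real.exp (-ρ) ^ (n / (4 * K)) :=
        pow_le_pow_left₀ (by linarith) (Real.one_sub_le_exp_neg _) _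
    _ = Real.exp (-(ρ * (n / (4 * K) : ℕ))) := by rw [← Real.exp_nat_mul]; congr 1; ring
    _ ≤ _ := by
      rw [Real.exp_le_exp, neg_le_neg_iff]
      calc Real.exp (L / 2) / (32 * L ^ 2) = Real.exp (-(L / 2)) * (n / (8 * (4 * L ^ 2))) := by
            rw [Real.exp_neg]
            have : (n : ℝ) = Real.exp (L / 2) * Real.exp (L / 2) := by
              rw [← Real.exp_add, add_halves, hLdef, Real.exp_log hn0]
            rw [this]
            field_simp
            norm_num
        _ ≤ ρ * (n / (8 * K)) := by gcongr
        _ ≤ _ := by gcongr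

end Supercritical

end Jigsaw

/-! ### Error terms and conclusion -/

namespace Jigsaw

variable {r : ℕ}

theorem tendsto_log_natCast : Tendsto (fun n : ℕ => Real.log n) atTop atTop :=
  Real.tendsto_log_atTop.comp tendsto_natCast_atTop_atTop

theorem tendsto_rFoldBinomial_one (p : ℕ → Fin r → unitInterval)
    (E : ∀ n, Set (RFoldGraph (Fin n) r)) {δ : ℕ → ℝ} (hδ : Tendsto δ atTop (𝓝 0))
    (h : ∀ᶠ n in atTop, prob (p n) (E n)ᶜ ≤ δ n) :
    Tendsto (fun n => rFoldBinomial n (p n) (E n)) atTop (𝓝 1) := by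
  have h1 : Tendsto (fun n => prob (p n) (E n)) atTop (𝓝 1) := by
    have h2 : Tendsto (fun n => 1 - δ n) atTop (𝓝 1) := by
      simpa using tendsto_const_nhds.sub hδ
    refine tendsto_of_tendsto_of_tendsto_of_le_of_le' h2 tendsto_const_nhds ?_
      (Eventually.of_forall fun n => prob_le_one _ _)
    filter_upwards [h] with n hn
    rw [prob_compl] at hn
    linarith
  have h3 := ENNReal.tendsto_ofReal h1
  rw [ENNReal.ofReal_one] at h3
  refine h3.congr fun n => ?_
  exact ofReal_measureReal

theorem exp_neg_two_mul_le_one_sub {x : ℝ} (hx0 : 0 ≤ x) (hx : x ≤ 1 / 2) :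
    Real.exp (-(2 * x)) ≤ 1 - x := by
  have h1 : Real.exp (-(2 * x)) ≤ 1 / (1 + 2 * x) := by
    rw [Real.exp_neg, ← one_div]
    exact one_div_le_one_div_of_le (by positivity) (by linarith [Real.add_one_le_exp (2 * x)])
  refine h1.trans ?_
  rw [div_le_iff₀ (by positivity)]
  nlinarith

/-- If the sparsest colour is too sparse, it has an isolated vertex and percolation is unlikely. -/
theorem prob_percolates_le_of_sparse_color {n : ℕ} {C : ℝ} (p : Fin r → unitInterval) (i : Fin r)
    (hn : 2 ≤ n) (hL : 1 ≤ Real.log n) (hC : 16 ≤ C) (hp : (p i : ℝ) ≤ Real.log n / (C * n)) :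
    prob p {G : RFoldGraph (Fin n) r | Percolates G} ≤
      Real.log n * Real.exp (-(Real.log n / 2)) + Real.exp (-Real.exp (Real.log n / 8)) := by
  set L := Real.log n with hLdef
  have hn0 : (0 : ℝ) < n := by positivity
  have hp0 := (p i).2.1
  have hnL : (n : ℝ) = Real.exp L := (Real.exp_log hn0).symm
  have hLn : L ≤ n := (Real.log_le_sub_one_of_pos hn0).trans (by linarith)
  have hp16 : (p i : ℝ) ≤ L / (16 * n) := hp.trans (by gcongr)
  have hpn : (p i : ℝ) * n ≤ L / 16 := by
    calc (p i : ℝ) * n ≤ L / (16 * n) * n := by gcongr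
      _ = _ := by field_simp
  have hphalf : (p i : ℝ) ≤ 1 / 2 := by
    refine hp16.trans ?_
    rw [div_le_div_iff₀ (by positivity) two_pos]
    linarith
  set w := ⌈Real.exp (L / 4)⌉₊ with hw
  have hwn : w ≤ n := Nat.ceil_le.2 (by rw [hnL, Real.exp_le_exp]; linarith)
  have hw1 : Real.exp (L / 4) ≤ w := Nat.le_ceil _
  have hw2 : (w : ℝ) ≤ 2 * Real.exp (L / 4) := by
    have h1 := Nat.ceil_lt_add_one (a := Real.exp (L / 4)) (Real.exp_pos _).le
    have h2 : 1 ≤ Real.exp (L / 4) := Real.one_le_exp (by linarith)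
    linarith
  obtain ⟨W, -, hWc⟩ := Finset.exists_subset_card_eq
    (s := (Finset.univ : Finset (Fin n))) (n := w) (by simpa using hwn)
  refine (prob_percolates_le_of_isolated hn p i W).trans ?_
  rw [hWc]
  refine add_le_add ?_ ?_
  · calc (w : ℝ) ^ 2 * (p i : ℝ) ≤ (2 * Real.exp (L / 4)) ^ 2 * (L / (16 * n)) := by gcongr
      _ = (1 / 4) * (L * (Real.exp (L / 4) ^ 2 / n)) := by ring
      _ = (1 / 4) * (L * Real.exp (-(L / 2))) := by
          rw [← Real.exp_nat_mul, hnL, ← Real.exp_sub]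
          congr 3
          push_cast
          ring
      _ ≤ _ := by
          have : 0 ≤ L * Real.exp (-(L / 2)) := by positivity
          linarith
  · rw [Real.exp_le_exp, neg_le_neg_iff]
    calc Real.exp (L / 8) = Real.exp (L / 4) * Real.exp (-(L / 8)) := by
          rw [← Real.exp_add]; congr 1; ring
      _ ≤ w * (1 - (p i : ℝ)) ^ n := by
          gcongr
          calc Real.exp (-(L / 8)) ≤ Real.exp (n * (-(2 * p i))) := by
                rw [Real.exp_le_exp]; linarith
            _ = Real.exp (-(2 * p i)) ^ n := Real.exp_nat_mul _ _
            _ ≤ _ := pow_le_pow_left₀ (Real.exp_pos _).le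
                (exp_neg_two_mul_le_one_sub hp0 hphalf) _

theorem Supercritical.prob_not_percolates_le {n : ℕ} {p : Fin r → unitInterval} {D : ℝ}
    (hr : 2 ≤ r) (h : Supercritical (2 ^ (r + 3) * D) n p)
    (hD : (48 * (2 * (r - 1) : ℕ) : ℝ) ^ (2 * (r - 1)) ≤ D) (hD32 : 32 ≤ D)
    (hDr : (r : ℝ) + 4 ≤ D) (hL : 1 ≤ Real.log n)
    (hn : 2 * (2 ^ (r + 3) * D) * Real.log n ^ 3 ≤ n) (hn8 : 32 * Real.log n ^ 2 ≤ n) :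
    prob p {G : RFoldGraph (Fin n) r | Percolates G}ᶜ ≤
      Real.exp (-(Real.exp (Real.log n / 2) / (32 * Real.log n ^ 2))) + 1 / n := by
  -- Chosen so that `log n < 2^a ≤ 2 log n`; after `2a` doublings a layer has at least `(log n)^2`
  -- vertices.
  set a := Nat.log 2 ⌊Real.log n⌋₊ + 1 with ha
  have hfl : 1 ≤ ⌊Real.log n⌋₊ := Nat.one_le_floor_iff _ |>.2 hL
  have ha1 : (2 : ℝ) ^ a ≤ 2 * Real.log n := by
    have h1 : 2 ^ Nat.log 2 ⌊Real.log n⌋₊ ≤ ⌊Real.log n⌋₊ := Nat.pow_log_le_self 2 (by omega)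
    have h2 : ((2 ^ Nat.log 2 ⌊Real.log n⌋₊ : ℕ) : ℝ) ≤ Real.log n :=
      (Nat.le_floor_iff (by linarith)).1 h1
    rw [ha, pow_succ]
    push_cast at h2
    linarith
  have ha2 : Real.log n ≤ 2 ^ a := by
    have h1 : ⌊Real.log n⌋₊ < 2 ^ a := Nat.lt_pow_succ_log_self (by norm_num) _
    have h2 := (Nat.floor_lt (by linarith)).1 h1
    push_cast at h2
    exact h2.le
  have hsub : {G : RFoldGraph (Fin n) r | Percolates G}ᶜ ⊆
      noSeed r (2 * a) (Finset.univ : Finset (Fin n)) ∪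
        {G : RFoldGraph (Fin n) r | ∃ S : Finset (Fin n), Real.log n ^ 2 ≤ S.card ∧
          S ≠ Finset.univ ∧ ∀ x ∉ S, ¬ Joined G S x} := by
    intro G hG
    by_contra hcon
    rw [Set.mem_union, not_or] at hcon
    obtain ⟨h1, h2⟩ := hcon
    simp only [noSeed, Set.mem_ofPred_eq, not_forall, not_not] at h1
    obtain ⟨v, -, hv⟩ := h1
    refine hG (percolates_of_grows hv fun S hS hSu => ?_)
    by_contra! hcl
    refine h2 ⟨S, ?_, hSu, hcl⟩
    calc Real.log n ^ 2 ≤ (2 ^ a) ^ 2 := by gcongr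
      _ = ((2 ^ (2 * a) : ℕ) : ℝ) := by push_cast; rw [mul_comm, pow_mul]
      _ ≤ S.card := by exact_mod_cast hS
  refine (prob_mono p hsub).trans ((prob_union_le p _ _).trans (add_le_add ?_ ?_))
  · exact h.prob_noSeed_univ_le hr hD hD32 hL ha1 ha2 hn hn8
  · refine h.prob_exists_closed_le ?_ hL ?_
    · rw [pow_add]
      have : (0 : ℝ) < 2 ^ r := by positivity
      have h2 : (2 : ℝ) ^ r * (r + 4) ≤ 2 ^ r * D := by gcongr
      have h3 : (0 : ℝ) ≤ 2 ^ r * (r + 4) := by positivity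
      linarith
    · nlinarith

theorem tendsto_sparse_error :
    Tendsto (fun n : ℕ => 2 * Real.exp 4 / n + (Real.log n * Real.exp (-(Real.log n / 2)) +
      Real.exp (-Real.exp (Real.log n / 8)))) atTop (𝓝 0) := by
  have h1 : Tendsto (fun n : ℕ => 2 * Real.exp 4 / (n : ℝ)) atTop (𝓝 0) :=
    tendsto_const_div_atTop_nhds_zero_nat _
  have h2 : Tendsto (fun n : ℕ => Real.log n * Real.exp (-(Real.log n / 2))) atTop (𝓝 0) := by
    have h := ((Real.tendsto_pow_mul_exp_neg_atTop_nhds_zero 1).comp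
      (tendsto_log_natCast.atTop_div_const two_pos)).const_mul 2
    rw [mul_zero] at h
    refine h.congr fun n => ?_
    simp only [Function.comp, pow_one]
    ring
  have h3 : Tendsto (fun n : ℕ => Real.exp (-Real.exp (Real.log n / 8))) atTop (𝓝 0) :=
    Real.tendsto_exp_neg_atTop_nhds_zero.comp
      (Real.tendsto_exp_atTop.comp (tendsto_log_natCast.atTop_div_const (by norm_num)))
  simpa using h1.add (h2.add h3)

theorem tendsto_dense_error :
    Tendsto (fun n : ℕ => Real.exp (-(Real.exp (Real.log n / 2) / (32 * Real.log n ^ 2))) +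
      1 / (n : ℝ)) atTop (𝓝 0) := by
  have h1 : Tendsto (fun n : ℕ => 1 / (n : ℝ)) atTop (𝓝 0) :=
    tendsto_const_div_atTop_nhds_zero_nat _
  have h2 : Tendsto (fun n : ℕ => Real.exp (Real.log n / 2) / (32 * Real.log n ^ 2))
      atTop atTop := by
    have h := ((Real.tendsto_exp_div_pow_atTop 2).comp
      (tendsto_log_natCast.atTop_div_const two_pos)).atTop_div_const
        (show (0 : ℝ) < 128 by norm_num)
    refine h.congr fun n => ?_
    simp only [Function.comp]
    rw [div_pow, div_div, div_mul_eq_mul_div]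
    congr 1
    ring
  simpa using (Real.tendsto_exp_neg_atTop_nhds_zero.comp h2).add h1

end Jigsaw

theorem theorem1 (r : ℕ) (hr : 2 ≤ r) :
    ∃ C : ℝ, 0 < C ∧
      ∀ p : ℕ → Fin r → unitInterval, (∀ n, Monotone (p n)) →
        ((∀ᶠ n : ℕ in atTop,
            (∃ i ∈ Finset.Icc 2 r,
              Jigsaw.prefixProd (p n) i ≤ 1 / (C * n * Real.log n ^ (i - 1))) ∨
            Jigsaw.prefixProd (p n) 1 ≤ Real.log n / (C * n)) →
          Tendsto (fun n : ℕ => Jigsaw.rFoldBinomial n (p n) {G | ¬ Jigsaw.Percolates G})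
            atTop (𝓝 1)) ∧
        ((∀ᶠ n : ℕ in atTop,
            (∀ i ∈ Finset.Icc 2 r,
              C / (n * Real.log n ^ (i - 1)) ≤ Jigsaw.prefixProd (p n) i) ∧
            C * Real.log n / n ≤ Jigsaw.prefixProd (p n) 1) →
          Tendsto (fun n : ℕ => Jigsaw.rFoldBinomial n (p n) {G | Jigsaw.Percolates G})
            atTop (𝓝 1)) := by
  open Jigsaw in
  -- The summands serve, in order, the early layers, the late layers, the closed sets and the
  -- subcritical union bound.
  set D : ℝ := (48 * (2 * (r - 1) : ℕ) : ℝ) ^ (2 * (r - 1)) + 32 + (r + 4) +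
    Real.exp 4 * 4 ^ r with hDdef
  have hpos1 : (0 : ℝ) ≤ (48 * (2 * (r - 1) : ℕ) : ℝ) ^ (2 * (r - 1)) := by positivity
  have hpos2 : (0 : ℝ) ≤ Real.exp 4 * 4 ^ r := by positivity
  have hpos3 : (0 : ℝ) ≤ r := Nat.cast_nonneg r
  have hD0 : 0 < D := by linarith
  have hDC : D ≤ 2 ^ (r + 3) * D := le_mul_of_one_le_left hD0.le (one_le_pow₀ (by norm_num))
  refine ⟨2 ^ (r + 3) * D, by positivity, fun p hp => ⟨fun h => ?_, fun h => ?_⟩⟩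
  -- The alternative that holds, and the index `i`, may change with `n`, so the two error bounds,
  -- both independent of `p` and `i`, are added.
  · refine tendsto_rFoldBinomial_one p _ tendsto_sparse_error ?_
    filter_upwards [h, eventually_one_le_log, eventually_ge_atTop 3] with n hn hL hn3
    have hcompl : {G : RFoldGraph (Fin n) r | ¬ Percolates G}ᶜ = {G | Percolates G} := by
      ext G; simp
    have hn0 : (0 : ℝ) < n := by positivity
    rw [hcompl]
    rcases hn with ⟨i, hi, hPi⟩ | hP1
    · obtain ⟨hi2, hir⟩ := Finset.mem_Icc.1 hi
      refine (prob_percolates_le_of_prefixProd_le (p n) hn3 (by omega) hir (by linarith)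
        hPi).trans (le_add_of_nonneg_right (by positivity))
    · have hfil : (Finset.univ.filter fun j : Fin r => j.val < 1) = {⟨0, by omega⟩} := by
        ext j
        simp [Fin.ext_iff]
      rw [prefixProd, hfil, Finset.prod_singleton] at hP1
      exact (prob_percolates_le_of_sparse_color (p n) _ (by omega) hL (by linarith) hP1).trans
        (le_add_of_nonneg_left (by positivity))
  · refine tendsto_rFoldBinomial_one p _ tendsto_dense_error ?_
    filter_upwards [h, eventually_one_le_log, eventually_mul_log_pow_le (2 * (2 ^ (r + 3) * D)) 3,
      eventually_mul_log_pow_le 32 2] with n hn hL hn3 hn2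
    exact Supercritical.prob_not_percolates_le hr ⟨hp n, hn.1, hn.2⟩ (by linarith) (by linarith)
      (by linarith) hL hn3 hn2
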